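/- Let $\mathbb{H}^n=\mathbb{C}^n\times\mathbb{R}$ be the Heisenberg group with $(z,t)(w,s)=(z+w,\,t+s+\tfrac12\mathrm{Im}(z\cdot\overline{w}))$ and Haar measure $dz\,dt$. For $z=x+iy$ and $\lambda\in\mathbb{R}\setminus\{0\}$ let $\pi_\lambda(z,t)$ be the unitary operator on $L^2(\mathbb{R}^n)$ given by $\pi_\lambda(z,t)\psi(\xi)=e^{2\pi i\lambda t}e^{2\pi i\lambda(x\cdot\xi+\frac12x\cdot y)}\psi(\xi+y)$. Let $\mathcal{B}_2$ be the Hilbert space of Hilbert–Schmidt operators on $L^2(\mathbb{R}^n)$. Let $f\mapsto\widehat f$ be the group Fourier transform $L^2(\mathbb{H}^n)\to L^2(\mathbb{R}\setminus\{0\},\mathcal{B}_2;|\lambda|^nd\lambda)$, that is, the continuous extension of $\widehat f(\lambda)=\int_{\mathbb{H}^n}f(z,t)\,\pi_\lambda(z,t)\,dz\,dt$ from $L^1(\mathbb{H}^n)\cap L^2(\mathbb{H}^n)$. For $f\in L^2(\mathbb{H}^n)$ and $\lambda\in(0,1]$ put $$\mathscr{T}f(\lambda)=\bigl(|\lambda+r|^{n/2}\,\widehat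 f(\lambda+r)\bigr)_{r\in\mathbb{Z}},$$ which lies in $\ell^2(\mathbb{Z},\mathcal{B}_2)$ for a.e. $\lambda\in(0,1]$. Let $K_f^\lambda\in L^2(\mathbb{R}^n\times\mathbb{R}^n)$ be the integral kernel of $\widehat f(\lambda)$; since $\widehat f(\lambda)$ is the Weyl transform $W_\lambda(f^\lambda)$ of the inverse Fourier transform $f^\lambda$ of $f$ in the central variable, $K_f^\lambda$ is the Weyl kernel of $f^\lambda$. For $k,l\in\mathbb{Z}^n$ and a.e. $\lambda\in(0,1]$ define $$G_{k,l}^{f}(\lambda)=\sum_{r\in\mathbb{Z}}\sum_{s\in\mathbb{Z}^n}\int_{[0,1)^n}\int_{\mathbb{R}^n}K_f^{\lambda+r}(\xi+s,\eta)\,\overline{K_f^{\lambda+r}(\xi+s+l,\eta)}\,e^{-2\pi i(\lambda+r)k\cdot(l+2\xi)}e^{-4\pi i\lambda k\cdot s}\,d\eta\,d\xi\,|\lambda+r|^n .$$ We say that $f$ satisfies condition C if, for every $(k,l)\in\mathbb{Z}^{2n}\setminus\{(0,0)\}$, $G_{k,l}^f(\lambda)=0$ for a.e. $\lambda\in(0,1]$.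 For $g\in\mathbb{H}^n$ let $L_gf(X)=f(g^{-1}X)$, and for $(k,l,m)\in\mathbb{Z}^n\times\mathbb{Z}^n\times\mathbb{Z}$ write $(2k,l,m)$ for the point $(2k+il,m)$ of $\mathbb{H}^n$. For $\varphi\in L^2(\mathbb{H}^n)$ let $V(\varphi)$ be the closed linear span of $\{L_{(2k,l,m)}\varphi:(k,l,m)\in\mathbb{Z}^{2n+1}\}$ in $L^2(\mathbb{H}^n)$. **Theorem.** Let $\mathscr{A}=\{\varphi_j\}_{j\in J}$ be a countable family in $L^2(\mathbb{H}^n)$ such that $V(\varphi_i)$ is orthogonal to $V(\varphi_j)$ whenever $i\ne j$. Then the family $E(\mathscr{A})=\{L_{(2k,l,m)}\varphi_j:(k,l,m)\in\mathbb{Z}^{2n+1},\ j\in J\}$ is an orthonormal system in $L^2(\mathbb{H}^n)$ if and only if both of the following hold: 1. for a.e. $\lambda\in(0,1]$, $\{\mathscr{T}\varphi_j(\lambda):j\in J\}$ is an orthonormal system in $\ell^2(\mathbb{Z},\mathcal{B}_2)$; 2. every $\varphi_j$ satisfies condition C. -/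

import Mathlib

open MeasureTheory Filter Topology
open scoped ENNReal ComplexConjugate InnerProductSpace

noncomputable section

namespace HeisenbergShift

/-! ### The Heisenberg group -/

/-- Euclidean space `ℝⁿ`. -/
abbrev Rn (n : ℕ) : Type := EuclideanSpace ℝ (Fin n)

/-- The Heisenberg group `ℍⁿ = ℂⁿ × ℝ`. The point `(z, t)` with `z = x + i y` is stored through its
real coordinates `(x, y, t)`. -/
def Heis (n : ℕ) : Type := Rn n × Rn n × ℝ

/-- The point `(x + i y, t)` of `ℍⁿ`. -/
def Heis.mk {n : ℕ} (x y : Rn n) (t : ℝ) : Heis n := (x, y, t)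

/-- The coordinate `x = Re z` of `(z, t)`. -/
def Heis.x {n : ℕ} (X : Heis n) : Rn n := Prod.fst X

/-- The coordinate `y = Im z` of `(z, t)`. -/
def Heis.y {n : ℕ} (X : Heis n) : Rn n := Prod.fst (Prod.snd X)

/-- The central coordinate `t` of `(z, t)`. -/
def Heis.t {n : ℕ} (X : Heis n) : ℝ := Prod.snd (Prod.snd X)

theorem Heis.ext' {n : ℕ} {X Y : Heis n} (hx : X.x = Y.x) (hy : X.y = Y.y) (ht : X.t = Y.t) :
    X = Y :=
  Prod.ext hx (Prod.ext hy ht)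

instance (n : ℕ) : TopologicalSpace (Heis n) :=
  inferInstanceAs (TopologicalSpace (Rn n × Rn n × ℝ))

/-- `volume` on `ℍⁿ` is the Lebesgue measure `dz dt` on `ℂⁿ × ℝ`, which is the Haar measure. -/
instance (n : ℕ) : MeasureSpace (Heis n) :=
  inferInstanceAs (MeasureSpace (Rn n × Rn n × ℝ))

/-- The group law `(z, t) (w, s) = (z + w, t + s + ½ Im (z · w̄))`; for `z = x + i y` and
`w = u + i v` one has `Im (z · w̄) = y · u - x · v`. -/
instance (n : ℕ) : Mul (Heis n) :=
  ⟨fun X Y => Heis.mk (X.x + Y.x) (X.y + Y.y)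
    (X.t + Y.t + (1 / 2) * (inner ℝ X.y Y.x - inner ℝ X.x Y.y))⟩

instance (n : ℕ) : One (Heis n) := ⟨Heis.mk 0 0 0⟩

instance (n : ℕ) : Inv (Heis n) := ⟨fun X => Heis.mk (-X.x) (-X.y) (-X.t)⟩

@[simp] theorem Heis.mk_x {n : ℕ} (x y : Rn n) (t : ℝ) : (Heis.mk x y t).x = x := rfl
@[simp] theorem Heis.mk_y {n : ℕ} (x y : Rn n) (t : ℝ) : (Heis.mk x y t).y = y := rfl
@[simp] theorem Heis.mk_t {n : ℕ} (x y : Rn n) (t : ℝ) : (Heis.mk x y t).t = t := rfl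
@[simp] theorem Heis.mul_x {n : ℕ} (X Y : Heis n) : (X * Y).x = X.x + Y.x := rfl
@[simp] theorem Heis.mul_y {n : ℕ} (X Y : Heis n) : (X * Y).y = X.y + Y.y := rfl
@[simp] theorem Heis.mul_t {n : ℕ} (X Y : Heis n) :
    (X * Y).t = X.t + Y.t + (1 / 2) * (inner ℝ X.y Y.x - inner ℝ X.x Y.y) := rfl
@[simp] theorem Heis.one_x {n : ℕ} : (1 : Heis n).x = 0 := rfl
@[simp] theorem Heis.one_y {n : ℕ} : (1 : Heis n).y = 0 := rfl
@[simp] theorem Heis.one_t {n : ℕ} : (1 : Heis n).t = 0 := rfl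
@[simp] theorem Heis.inv_x {n : ℕ} (X : Heis n) : (X⁻¹).x = -X.x := rfl
@[simp] theorem Heis.inv_y {n : ℕ} (X : Heis n) : (X⁻¹).y = -X.y := rfl
@[simp] theorem Heis.inv_t {n : ℕ} (X : Heis n) : (X⁻¹).t = -X.t := rfl

instance (n : ℕ) : Group (Heis n) :=
  Group.ofLeftAxioms
    (fun X Y Z => by
      refine Heis.ext' ?_ ?_ ?_
      · simp [add_assoc]
      · simp [add_assoc]
      · simp only [Heis.mul_x, Heis.mul_y, Heis.mul_t, inner_add_left, inner_add_right]
        ring)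
    (fun X => by refine Heis.ext' ?_ ?_ ?_ <;> simp)
    (fun X => by
      refine Heis.ext' ?_ ?_ ?_
      · simp
      · simp
      · simp [real_inner_comm])

/-- Left multiplication preserves the measure `dz dt`. -/
theorem measurePreserving_mul_left {n : ℕ} (g : Heis n) :
    MeasurePreserving (fun X : Heis n => g * X) volume volume := by
  have h : MeasurePreserving
      (fun p : Rn n × (Rn n × ℝ) =>
        (g.x + p.1, (fun q : Rn n × ℝ =>
          (g.y + q.1, g.t + q.2 + (1 / 2) * (inner ℝ g.y p.1 - inner ℝ g.x q.1))) p.2))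
      (volume.prod (volume.prod volume)) (volume.prod (volume.prod volume)) := by
    refine MeasurePreserving.skew_product
      (g := fun (u : Rn n) (q : Rn n × ℝ) =>
          (g.y + q.1, g.t + q.2 + (1 / 2) * (inner ℝ g.y u - inner ℝ g.x q.1)))
      (measurePreserving_add_left volume g.x) ?_ (ae_of_all _ fun u => ?_)
    · refine Continuous.measurable ?_
      simp only [Function.uncurry_def]
      fun_prop
    · refine (MeasurePreserving.skew_product
        (g := fun (v : Rn n) (s : ℝ) => g.t + s + (1 / 2) * (inner ℝ g.y u - inner ℝ g.x v))
        (measurePreserving_add_left volume g.y) ?_ (ae_of_all _ fun v => ?_)).map_eq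
      · refine Continuous.measurable ?_
        simp only [Function.uncurry_def]
        fun_prop
      · have : (fun s : ℝ => g.t + s + (1 / 2) * (inner ℝ g.y u - inner ℝ g.x v))
            = fun s : ℝ => (g.t + (1 / 2) * (inner ℝ g.y u - inner ℝ g.x v)) + s := by
          funext s; ring
        rw [this]
        exact (measurePreserving_add_left volume _).map_eq
  exact h

/-- `L²(ℍⁿ)`. -/
abbrev L2H (n : ℕ) : Type := Lp ℂ 2 (volume : Measure (Heis n))

/-- Left translation `L_g φ (X) = φ (g⁻¹ X)` on `L²(ℍⁿ)`. -/
def leftTranslate {n : ℕ} (g : Heis n) (φ : L2H n) : L2H n :=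
  Lp.compMeasurePreserving (fun X : Heis n => g⁻¹ * X) (measurePreserving_mul_left g⁻¹) φ

/-- The vector of `ℝⁿ` with the integer coordinates `k`. -/
def intVec {n : ℕ} (k : Fin n → ℤ) : Rn n := WithLp.toLp 2 fun i => (k i : ℝ)

/-- The point `(2k, l, m)` of the standard lattice of `ℍⁿ`. -/
def latticePoint {n : ℕ} (k l : Fin n → ℤ) (m : ℤ) : Heis n :=
  Heis.mk ((2 : ℝ) • intVec k) (intVec l) (m : ℝ)

/-- The principal shift-invariant space `V(φ)`, the closed span of the lattice translates
`L_{(2k,l,m)} φ`. -/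
def principalShiftInvariant {n : ℕ} (φ : L2H n) : Submodule ℂ (L2H n) :=
  (Submodule.span ℂ (Set.range fun p : (Fin n → ℤ) × (Fin n → ℤ) × ℤ =>
    leftTranslate (latticePoint p.1 p.2.1 p.2.2) φ)).topologicalClosure

/-- The system `E(𝒜) = {L_{(2k,l,m)} φ_j}`, as a family indexed by `(j, k, l, m)`. -/
def translateSystem {n : ℕ} {ι : Type*} (φ : ι → L2H n) :
    ι × (Fin n → ℤ) × (Fin n → ℤ) × ℤ → L2H n :=
  fun p => leftTranslate (latticePoint p.2.1 p.2.2.1 p.2.2.2) (φ p.1)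

/-! ### Hilbert–Schmidt operators -/

section HilbertSchmidt

variable (H : Type*) [NormedAddCommGroup H] [InnerProductSpace ℂ H] [CompleteSpace H]

/-- Index set of a fixed Hilbert basis of `H`. -/
def basisIndex : Set H := (exists_hilbertBasis ℂ H).choose

/-- A fixed Hilbert basis of `H`. -/
def stdHilbertBasis : HilbertBasis (basisIndex H) ℂ H :=
  (exists_hilbertBasis ℂ H).choose_spec.choose

/-- Bounded operators `A` with `∑ᵢ ‖A eᵢ‖² < ∞` for the fixed Hilbert basis `(eᵢ)`. -/
def hsSubmodule : Submodule ℂ (H →L[ℂ] H) where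
  carrier := {A | Memℓp (fun i => A (stdHilbertBasis H i)) 2}
  add_mem' := fun ha hb => ha.add hb
  zero_mem' := zero_memℓp
  smul_mem' := fun c _ ha => ha.const_smul c

/-- The space `𝓑₂` of Hilbert–Schmidt operators on `H`. It carries the Hilbert–Schmidt inner product
`⟪A, B⟫ = ∑ᵢ ⟪A eᵢ, B eᵢ⟫` (see `HS.inner_def`), not the operator norm. -/
def HS : Type _ := hsSubmodule H

namespace HS

instance : AddCommGroup (HS H) := inferInstanceAs (AddCommGroup (hsSubmodule H))

instance : Module ℂ (HS H) := inferInstanceAs (Module ℂ (hsSubmodule H))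

variable {H}

/-- The underlying bounded operator. -/
def toCLM (A : HS H) : H →L[ℂ] H := Subtype.val A

variable (H)

/-- The linear map `A ↦ (A eᵢ)ᵢ` into `ℓ²(H)`, which induces the Hilbert–Schmidt norm. -/
def toSeq : HS H →ₗ[ℂ] lp (fun _ : basisIndex H => H) 2 where
  toFun A := ⟨fun i => A.toCLM (stdHilbertBasis H i), A.2⟩
  map_add' _ _ := rfl
  map_smul' _ _ := rfl

theorem toSeq_injective : Function.Injective (toSeq H) := by
  intro A B h
  refine Subtype.ext ?_
  refine ContinuousLinearMap.ext_on (s := Set.range (stdHilbertBasis H)) ?_ ?_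
  · have := (stdHilbertBasis H).dense_span
    rw [Submodule.dense_iff_topologicalClosure_eq_top]
    exact this
  · rintro _ ⟨i, rfl⟩
    exact congrArg (fun f : lp (fun _ : basisIndex H => H) 2 => f i) h

instance : NormedAddCommGroup (HS H) :=
  NormedAddCommGroup.induced (HS H) _ (toSeq H) (toSeq_injective H)

instance : InnerProductSpace ℂ (HS H) := InnerProductSpace.induced (toSeq H)

theorem inner_def (A B : HS H) :
    inner ℂ A B = ∑' i, inner ℂ (A.toCLM (stdHilbertBasis H i)) (B.toCLM (stdHilbertBasis H i)) :=
  rfl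

end HS

end HilbertSchmidt

/-! ### The Schrödinger representations and the group Fourier transform -/

/-- `L²(ℝⁿ)`. -/
abbrev L2R (n : ℕ) : Type := Lp ℂ 2 (volume : Measure (Rn n))

theorem memLp_schrodinger {n : ℕ} (lam : ℝ) (X : Heis n) (φ : L2R n) :
    MemLp (fun ξ : Rn n =>
      Complex.exp (2 * Real.pi * Complex.I * (lam * X.t : ℝ)) *
      Complex.exp (2 * Real.pi * Complex.I *
        (lam * (inner ℝ X.x ξ + (1 / 2) * inner ℝ X.x X.y) : ℝ)) * φ (ξ + X.y)) 2 volume := by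
  have h1 : MemLp (fun ξ : Rn n => φ (ξ + X.y)) 2 volume :=
    (Lp.memLp φ).comp_measurePreserving (measurePreserving_add_right volume X.y)
  refine h1.of_le ?_ (ae_of_all _ fun ξ => ?_)
  · refine AEStronglyMeasurable.mul (Continuous.aestronglyMeasurable ?_) h1.1
    fun_prop
  · have e (r : ℝ) : ‖Complex.exp (2 * Real.pi * Complex.I * (r : ℝ))‖ = 1 := by
      rw [show 2 * (Real.pi : ℂ) * Complex.I * (r : ℂ) = ((2 * Real.pi * r : ℝ) : ℂ) * Complex.I by
        push_cast; ring]
      exact Complex.norm_exp_ofReal_mul_I _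
    rw [norm_mul, norm_mul, e, e, one_mul, one_mul]

/-- The representation `π_λ` of `ℍⁿ` on `L²(ℝⁿ)`:
`π_λ(z, t) φ (ξ) = e^{2πiλt} e^{2πiλ(x·ξ + ½ x·y)} φ(ξ + y)` for `z = x + i y`. -/
def schrodinger {n : ℕ} (lam : ℝ) (X : Heis n) (φ : L2R n) : L2R n :=
  (memLp_schrodinger lam X φ).toLp

/-- The measure `dμ(λ) = |λ|ⁿ dλ`. -/
def plancherelMeasure (n : ℕ) : Measure ℝ :=
  volume.withDensity fun lam => ENNReal.ofReal (|lam| ^ n)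

/-- The space `L²(ℝ*, 𝓑₂; dμ)`; the point `0` is a null set. -/
abbrev L2HS (n : ℕ) : Type := Lp (HS (L2R n)) 2 (plancherelMeasure n)

/-- The graph of the group Fourier transform on `L¹(ℍⁿ) ∩ L²(ℍⁿ)`: all pairs `(f, F)` with `f`
integrable and `F(λ) = ∫ f(X) π_λ(X) dX` for almost every `λ`, the integral being taken strongly,
that is, as a Bochner integral in `L²(ℝⁿ)` after applying the operators to a vector. -/
def fourierGraph (n : ℕ) : Set (L2H n × L2HS n) :=
  {p | Integrable (p.1 : Heis n → ℂ) volume ∧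
    ∀ᵐ lam ∂(plancherelMeasure n), ∀ φ : L2R n,
      (p.2 lam).toCLM φ = ∫ X : Heis n, p.1 X • schrodinger lam X φ}

open Classical in
/-- The group Fourier transform `f ↦ f̂` from `L²(ℍⁿ)` to `L²(ℝ*, 𝓑₂; dμ)`: the continuous extension
of the transform on `L¹(ℍⁿ) ∩ L²(ℍⁿ)`, so that `f̂` is the element for which `(f, f̂)` lies in the
closure of the graph. -/
def groupFourier {n : ℕ} (f : L2H n) : L2HS n :=
  if h : ∃ F : L2HS n, (f, F) ∈ closure (fourierGraph n) then h.choose else 0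

open Classical in
/-- `𝒯 f (λ) = (|λ + r|^{n/2} f̂(λ + r))_{r ∈ ℤ}`, an element of `ℓ²(ℤ, 𝓑₂)`; it is set to `0` on the
null set of those `λ` for which the sequence is not square summable. -/
def rangeMap {n : ℕ} (f : L2H n) (lam : ℝ) : lp (fun _ : ℤ => HS (L2R n)) 2 :=
  if h : Memℓp (fun r : ℤ =>
      ((|lam + r| ^ ((n : ℝ) / 2) : ℝ) : ℂ) • groupFourier f (lam + r)) 2
  then ⟨_, h⟩ else 0

/-! ### The Weyl kernel and condition C -/

/-- `K ∈ L²(ℝⁿ × ℝⁿ)` is the integral kernel of `A`: `A φ (ξ) = ∫ K(ξ, η) φ(η) dη`. -/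
def IsIntegralKernel {n : ℕ} (A : L2R n →L[ℂ] L2R n)
    (K : Lp ℂ 2 (volume : Measure (Rn n × Rn n))) : Prop :=
  ∀ φ : L2R n, A φ =ᵐ[volume] fun ξ => ∫ η, K (ξ, η) * φ η

open Classical in
/-- The integral kernel of a Hilbert–Schmidt operator on `L²(ℝⁿ)`, an element of `L²(ℝⁿ × ℝⁿ)`. -/
def integralKernel {n : ℕ} (A : HS (L2R n)) : Lp ℂ 2 (volume : Measure (Rn n × Rn n)) :=
  if h : ∃ K, IsIntegralKernel A.toCLM K then h.choose else 0

/-- The kernel `K^λ_{φ^λ}(ξ, η)` of the Weyl transform `W_λ(φ^λ)`, where `φ^λ` is the inverse Fourier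
transform of `φ` in the central variable; `W_λ(φ^λ)` is the operator `φ̂(λ)`. -/
def weylKernel {n : ℕ} (φ : L2H n) (lam : ℝ) (ξ η : Rn n) : ℂ :=
  integralKernel (groupFourier φ lam) (ξ, η)

/-- The unit cube `[0,1)ⁿ`, representing the torus `𝕋ⁿ`. -/
def unitCube (n : ℕ) : Set (Rn n) := {ξ | ∀ i, ξ i ∈ Set.Ico (0 : ℝ) 1}

/-- The periodization `G_{k,l}^φ(λ)`. -/
def periodization {n : ℕ} (φ : L2H n) (k l : Fin n → ℤ) (lam : ℝ) : ℂ :=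
  ∑' r : ℤ, ∑' s : Fin n → ℤ,
    (∫ ξ in unitCube n, ∫ η : Rn n,
      weylKernel φ (lam + r) (ξ + intVec s) η *
        conj (weylKernel φ (lam + r) (ξ + intVec s + intVec l) η) *
        Complex.exp (-2 * Real.pi * Complex.I * (lam + r) *
          (inner ℝ (intVec k) (intVec l + (2 : ℝ) • ξ) : ℝ)) *
        Complex.exp (-4 * Real.pi * Complex.I * lam *
          (inner ℝ (intVec k) (intVec s) : ℝ))) *
    ((|lam + r| ^ n : ℝ) : ℂ)

/-- Condition C: `G_{k,l}^φ(λ) = 0` for a.e. `λ ∈ (0, 1]`, for all `(k, l) ≠ (0, 0)`. -/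
def ConditionC {n : ℕ} (φ : L2H n) : Prop :=
  ∀ k l : Fin n → ℤ, (k, l) ≠ (0, 0) →
    ∀ᵐ lam ∂(volume.restrict (Set.Ioc (0 : ℝ) 1)), periodization φ k l lam = 0

end HeisenbergShift

end

/-!
The group Fourier transform turns the lattice translations into a family of fibrewise operators over
`λ ∈ (0, 1]`, and orthonormality of translates into a statement about Fourier coefficients in `λ`.

*Plancherel.* For `f ∈ L¹ ∩ L²` the operator `∫ f(X) π_λ(X) dX` has the integral kernel
`K^λ(ξ, η) = ∫∫ f(x, η - ξ, t) e^{2πiλ(t + x·(ξ + η)/2)} dx dt`, a Euclidean Fourier transform of `f`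
in `(x, t)` in the coordinates `u = λ(ξ + η)/2`, `y = η - ξ`, whose Jacobian is `|λ|ⁿ`. With Plancherel
on `ℝⁿ × ℝ` and the unitary identification `kernelEquiv` of `L²(ℝⁿ × ℝⁿ)` with the Hilbert–Schmidt
operators, the transform is isometric on `L¹ ∩ L²`, so the closure of its graph is the graph of a
linear isometry (`groupFourierIsometry`). It intertwines `L_g` with `A(λ) ↦ π_λ(g) A(λ)`
(`groupFourier_leftTranslate`).

*Fibres.* Central translations act by the scalars `e^{2πiλm}`, which are `1`-periodic in `λ`. Splitting
`λ ∈ ℝ` into `λ ∈ (0, 1]` and `r ∈ ℤ`, the inner products `⟪L_{(2k,l,m)} f, g⟫`, `m ∈ ℤ`, become the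
Fourier coefficients of the integrable function `λ ↦ ⟪𝒯 (L_{(2k,l,0)} f)(λ), 𝒯 g(λ)⟫` on `(0, 1]`
(`inner_leftTranslate_latticePoint`), which they determine (`ae_eq_zero_of_fourierCoeff_eq_zero`). The
kernel of `π_λ(g) A` is the translated and modulated kernel of `A`; tiling `ℝⁿ` by integer translates
of the unit cube identifies this function, for `g = f`, with the periodization `G_{k,l}`
(`ae_periodization_eq`).

*Conclusion.* Translates of one generator are orthonormal iff `G_{k,l} = 0` almost everywhere for
`(k, l) ≠ 0` and `‖𝒯 f(λ)‖² = 1` almost everywhere. For different generators, the orthogonality of the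
generated spaces makes both the translates and almost all fibres orthogonal.
-/

open MeasureTheory Filter Topology
open scoped ENNReal ComplexConjugate InnerProductSpace

noncomputable section

namespace HeisenbergShift

/-! ### Square-integrable functions -/

theorem countable_basisIndex (H : Type*) [NormedAddCommGroup H] [InnerProductSpace ℂ H]
    [CompleteSpace H] [TopologicalSpace.SeparableSpace H] : Countable (basisIndex H) := by
  have hb := (stdHilbertBasis H).orthonormal
  refine Pairwise.countable_of_isOpen_disjoint
    (s := fun i : basisIndex H => Metric.ball (stdHilbertBasis H i) (1 / 2)) ?_
    (fun i => Metric.isOpen_ball) (fun i => ⟨_, Metric.mem_ball_self (by norm_num)⟩)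
  intro i j hij
  refine Metric.ball_disjoint_ball ?_
  have h : ‖stdHilbertBasis H i - stdHilbertBasis H j‖ ^ 2 = 2 := by
    rw [@norm_sub_sq ℂ, hb.2 hij, hb.1, hb.1]
    norm_num
  rw [dist_eq_norm]
  nlinarith [norm_nonneg (stdHilbertBasis H i - stdHilbertBasis H j)]

section SquareIntegrable

variable {α β E : Type*} [MeasurableSpace α] [MeasurableSpace β] {μ : Measure α} {ν : Measure β}
  [NormedAddCommGroup E]

theorem eLpNorm_two_sq (f : α → E) : eLpNorm f 2 μ ^ 2 = ∫⁻ a, ‖f a‖ₑ ^ 2 ∂μ := by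
  rw [eLpNorm_eq_lintegral_rpow_enorm_toReal (by norm_num) (by norm_num)]
  simp only [ENNReal.toReal_ofNat, ENNReal.rpow_ofNat]
  rw [← ENNReal.rpow_natCast, ← ENNReal.rpow_mul]
  norm_num

theorem memLp_two_iff {f : α → E} :
    MemLp f 2 μ ↔ AEStronglyMeasurable f μ ∧ ∫⁻ a, ‖f a‖ₑ ^ 2 ∂μ < ∞ := by
  rw [← eLpNorm_two_sq, MemLp]
  simp

theorem enorm_Lp_two_sq (f : Lp E 2 μ) : ‖f‖ₑ ^ 2 = ∫⁻ a, ‖f a‖ₑ ^ 2 ∂μ := by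
  rw [← eLpNorm_two_sq, Lp.enorm_def]

theorem enorm_toLp_two_sq {f : α → E} (hf : MemLp f 2 μ) :
    ‖hf.toLp f‖ₑ ^ 2 = ∫⁻ a, ‖f a‖ₑ ^ 2 ∂μ := by
  rw [← eLpNorm_two_sq, Lp.enorm_toLp]

theorem enorm_sq_eq_ofReal (x : E) : ‖x‖ₑ ^ 2 = ENNReal.ofReal (‖x‖ ^ 2) := by
  rw [ENNReal.ofReal_pow (norm_nonneg _), ofReal_norm]

theorem norm_eq_of_enorm_sq_eq {E F : Type*} [NormedAddCommGroup E] [NormedAddCommGroup F]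
    {x : E} {y : F} (h : ‖x‖ₑ ^ 2 = ‖y‖ₑ ^ 2) : ‖x‖ = ‖y‖ := by
  rw [← toReal_enorm, ← toReal_enorm, (ENNReal.pow_right_strictMono two_ne_zero).injective h]

theorem ae_memLp_two_slice [SFinite μ] [SFinite ν] {K : α × β → E}
    (hK : MemLp K 2 (μ.prod ν)) : ∀ᵐ a ∂μ, MemLp (fun b => K (a, b)) 2 ν := by
  obtain ⟨h1, h2⟩ := memLp_two_iff.1 hK
  have hm : AEMeasurable (fun p => ‖K p‖ₑ ^ 2) (μ.prod ν) := h1.enorm.pow_const 2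
  rw [lintegral_prod _ hm] at h2
  filter_upwards [ae_lt_top' hm.lintegral_prod_right' h2.ne, h1.prodMk_left] with a ha hb
  exact memLp_two_iff.2 ⟨hb, ha⟩

theorem integral_mul_eq_inner {k : α → ℂ} (hk : MemLp k 2 μ) (ψ : Lp ℂ 2 μ) :
    ∫ a, k a * ψ a ∂μ = inner ℂ (hk.star.toLp (star k)) ψ := by
  rw [L2.inner_def]
  refine integral_congr_ae ?_
  filter_upwards [hk.star.coeFn_toLp] with a ha
  rw [ha]
  simp [mul_comm]

theorem enorm_integral_mul_sq_le {k : α → ℂ} (hk : MemLp k 2 μ) (ψ : Lp ℂ 2 μ) :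
    ‖∫ a, k a * ψ a ∂μ‖ₑ ^ 2 ≤ (∫⁻ a, ‖k a‖ₑ ^ 2 ∂μ) * ‖ψ‖ₑ ^ 2 := by
  have h : ‖hk.star.toLp (star k)‖ₑ ^ 2 = ∫⁻ a, ‖k a‖ₑ ^ 2 ∂μ := by
    rw [enorm_toLp_two_sq]
    simp
  rw [integral_mul_eq_inner hk, ← h, ← mul_pow]
  gcongr
  simp only [enorm_eq_nnnorm]
  exact_mod_cast nnnorm_inner_le_nnnorm _ _

theorem tsum_enorm_inner_sq {H ι : Type*} [NormedAddCommGroup H] [InnerProductSpace ℂ H]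
    (b : HilbertBasis ι ℂ H) (u : H) : ∑' i, ‖inner ℂ u (b i)‖ₑ ^ 2 = ‖u‖ₑ ^ 2 := by
  have h := Complex.hasSum_re (b.hasSum_inner_mul_inner u u)
  have h1 : ∀ i, (inner ℂ u (b i) * inner ℂ (b i) u).re = ‖inner ℂ u (b i)‖ ^ 2 := fun i => by
    rw [← inner_conj_symm (b i) u, Complex.mul_conj, Complex.normSq_eq_norm_sq, Complex.ofReal_re]
  have h2 : (inner ℂ u u : ℂ).re = ‖u‖ ^ 2 := by
    rw [@norm_sq_eq_re_inner ℂ]; rfl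
  simp only [h1, h2] at h
  simp only [enorm_sq_eq_ofReal]
  rw [← ENNReal.ofReal_tsum_of_nonneg (fun _ => sq_nonneg _) h.summable, h.tsum_eq]

theorem tsum_enorm_integral_mul_sq {ι : Type*} (b : HilbertBasis ι ℂ (Lp ℂ 2 μ)) {k : α → ℂ}
    (hk : MemLp k 2 μ) :
    ∑' i, ‖∫ a, k a * b i a ∂μ‖ₑ ^ 2 = ∫⁻ a, ‖k a‖ₑ ^ 2 ∂μ := by
  simp only [integral_mul_eq_inner hk, tsum_enorm_inner_sq, enorm_toLp_two_sq]
  simp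

theorem memLp_two_mul_prod [SFinite μ] [SFinite ν] {f : α → ℂ} {g : β → ℂ} (hf : MemLp f 2 μ)
    (hg : MemLp g 2 ν) : MemLp (fun p : α × β => f p.1 * g p.2) 2 (μ.prod ν) := by
  rw [memLp_two_iff]
  refine ⟨hf.1.comp_fst.mul hg.1.comp_snd, ?_⟩
  simp only [enorm_mul, mul_pow]
  rw [lintegral_prod_mul (f := fun a => ‖f a‖ₑ ^ 2) (g := fun b => ‖g b‖ₑ ^ 2)
    (hf.1.enorm.pow_const 2) (hg.1.enorm.pow_const 2)]
  exact ENNReal.mul_lt_top (memLp_two_iff.1 hf).2 (memLp_two_iff.1 hg).2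

end SquareIntegrable

/-! ### Integral operators with square-integrable kernels -/

section KernelOperator

variable {α : Type*} [MeasurableSpace α] {μ : Measure α} [SigmaFinite μ]

theorem aestronglyMeasurable_kernel_integral {K : α × α → ℂ}
    (hK : AEStronglyMeasurable K (μ.prod μ)) (ψ : Lp ℂ 2 μ) :
    AEStronglyMeasurable (fun ξ => ∫ η, K (ξ, η) * ψ η ∂μ) μ :=
  (hK.mul (Lp.aestronglyMeasurable ψ).comp_snd).integral_prod_right'

theorem lintegral_kernel_integral_le (K : Lp ℂ 2 (μ.prod μ)) (ψ : Lp ℂ 2 μ) :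
    ∫⁻ ξ, ‖∫ η, K (ξ, η) * ψ η ∂μ‖ₑ ^ 2 ∂μ ≤ ‖K‖ₑ ^ 2 * ‖ψ‖ₑ ^ 2 := by
  have hm : AEMeasurable (fun p => ‖K p‖ₑ ^ 2) (μ.prod μ) :=
    (Lp.aestronglyMeasurable K).enorm.pow_const 2
  calc ∫⁻ ξ, ‖∫ η, K (ξ, η) * ψ η ∂μ‖ₑ ^ 2 ∂μ
      ≤ ∫⁻ ξ, (∫⁻ η, ‖K (ξ, η)‖ₑ ^ 2 ∂μ) * ‖ψ‖ₑ ^ 2 ∂μ := by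
        refine lintegral_mono_ae ?_
        filter_upwards [ae_memLp_two_slice (Lp.memLp K)] with ξ hξ
        exact enorm_integral_mul_sq_le hξ ψ
    _ = ‖K‖ₑ ^ 2 * ‖ψ‖ₑ ^ 2 := by
        rw [lintegral_mul_const'' _ hm.lintegral_prod_right', ← lintegral_prod _ hm,
          enorm_Lp_two_sq K]

theorem memLp_kernel_integral (K : Lp ℂ 2 (μ.prod μ)) (ψ : Lp ℂ 2 μ) :
    MemLp (fun ξ => ∫ η, K (ξ, η) * ψ η ∂μ) 2 μ :=
  memLp_two_iff.2 ⟨aestronglyMeasurable_kernel_integral (Lp.aestronglyMeasurable K) ψ,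
    (lintegral_kernel_integral_le K ψ).trans_lt
      (ENNReal.mul_lt_top (by simp) (by simp))⟩

/-- The bounded operator on `L²(μ)` with the integral kernel `K ∈ L²(μ × μ)`. -/
def kernelCLM (K : Lp ℂ 2 (μ.prod μ)) : Lp ℂ 2 μ →L[ℂ] Lp ℂ 2 μ :=
  LinearMap.mkContinuous
    { toFun := fun ψ => (memLp_kernel_integral K ψ).toLp
      map_add' := fun ψ χ => by
        rw [← MemLp.toLp_add]
        refine MemLp.toLp_congr _ _ ?_
        filter_upwards [ae_memLp_two_slice (Lp.memLp K)] with ξ hξ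
        simp only [Pi.add_apply]
        rw [integral_mul_eq_inner hξ, integral_mul_eq_inner hξ, integral_mul_eq_inner hξ,
          inner_add_right]
      map_smul' := fun c ψ => by
        rw [RingHom.id_apply, ← MemLp.toLp_const_smul]
        refine MemLp.toLp_congr _ _ ?_
        filter_upwards [ae_memLp_two_slice (Lp.memLp K)] with ξ hξ
        simp only [Pi.smul_apply]
        rw [integral_mul_eq_inner hξ, integral_mul_eq_inner hξ, inner_smul_right, smul_eq_mul] }
    ‖K‖ (fun ψ => by
      have h := lintegral_kernel_integral_le K ψ
      rw [← enorm_toLp_two_sq (memLp_kernel_integral K ψ), ← mul_pow] at h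
      have h' := (ENNReal.pow_le_pow_left_iff two_ne_zero).1 h
      have h3 := ENNReal.toReal_mono (ENNReal.mul_ne_top (by simp) (by simp)) h'
      rwa [ENNReal.toReal_mul, toReal_enorm, toReal_enorm, toReal_enorm] at h3)

theorem kernelCLM_apply_ae (K : Lp ℂ 2 (μ.prod μ)) (ψ : Lp ℂ 2 μ) :
    kernelCLM K ψ =ᵐ[μ] fun ξ => ∫ η, K (ξ, η) * ψ η ∂μ :=
  (memLp_kernel_integral K ψ).coeFn_toLp

/-- Parseval in the second variable of the kernel, integrated over the first one. -/
theorem tsum_enorm_kernelCLM_sq {ι : Type*} [Countable ι] (b : HilbertBasis ι ℂ (Lp ℂ 2 μ))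
    (K : Lp ℂ 2 (μ.prod μ)) : ∑' i, ‖kernelCLM K (b i)‖ₑ ^ 2 = ‖K‖ₑ ^ 2 := by
  have hm : AEMeasurable (fun p => ‖K p‖ₑ ^ 2) (μ.prod μ) :=
    (Lp.aestronglyMeasurable K).enorm.pow_const 2
  have h (i : ι) : ‖kernelCLM K (b i)‖ₑ ^ 2 = ∫⁻ ξ, ‖∫ η, K (ξ, η) * b i η ∂μ‖ₑ ^ 2 ∂μ :=
    enorm_toLp_two_sq (memLp_kernel_integral K (b i))
  simp only [h]
  rw [← lintegral_tsum fun i => (memLp_kernel_integral K (b i)).1.enorm.pow_const 2,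
    enorm_Lp_two_sq K, lintegral_prod _ hm]
  refine lintegral_congr_ae ?_
  filter_upwards [ae_memLp_two_slice (Lp.memLp K)] with ξ hξ
  exact tsum_enorm_integral_mul_sq b hξ

theorem kernelCLM_add (K L : Lp ℂ 2 (μ.prod μ)) :
    kernelCLM (K + L) = kernelCLM K + kernelCLM L := by
  ext1 ψ
  refine Lp.ext ?_
  filter_upwards [kernelCLM_apply_ae (K + L) ψ, kernelCLM_apply_ae K ψ, kernelCLM_apply_ae L ψ,
    Lp.coeFn_add (kernelCLM K ψ) (kernelCLM L ψ), ae_memLp_two_slice (Lp.memLp K),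
    ae_memLp_two_slice (Lp.memLp L), Measure.ae_ae_of_ae_prod (Lp.coeFn_add K L)]
    with ξ h1 h2 h3 h4 h5 h6 h7
  rw [add_apply, h4, Pi.add_apply, h1, h2, h3,
    ← integral_add (f := fun η => K (ξ, η) * ψ η) (g := fun η => L (ξ, η) * ψ η)
      (h5.integrable_mul (Lp.memLp ψ)) (h6.integrable_mul (Lp.memLp ψ))]
  refine integral_congr_ae ?_
  filter_upwards [h7] with η hη
  rw [hη, Pi.add_apply, add_mul]

theorem kernelCLM_smul (c : ℂ) (K : Lp ℂ 2 (μ.prod μ)) :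
    kernelCLM (c • K) = c • kernelCLM K := by
  ext1 ψ
  refine Lp.ext ?_
  filter_upwards [kernelCLM_apply_ae (c • K) ψ, kernelCLM_apply_ae K ψ,
    Lp.coeFn_smul c (kernelCLM K ψ), Measure.ae_ae_of_ae_prod (Lp.coeFn_smul c K)]
    with ξ h1 h2 h4 h7
  rw [smul_apply, h4, Pi.smul_apply, h1, h2, ← integral_smul]
  refine integral_congr_ae ?_
  filter_upwards [h7] with η hη
  rw [hη, Pi.smul_apply, smul_mul_assoc]

theorem memℓp_two_iff {ι E : Type*} [NormedAddCommGroup E] {f : ι → E} :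
    Memℓp f 2 ↔ Summable fun i => ‖f i‖ ^ 2 := by
  rw [memℓp_gen_iff (by norm_num)]
  simp

theorem memℓp_two_of_tsum_enorm_lt {ι E : Type*} [NormedAddCommGroup E] {f : ι → E}
    (h : ∑' i, ‖f i‖ₑ ^ 2 ≠ ∞) : Memℓp f 2 := by
  rw [memℓp_two_iff]
  have := ENNReal.summable_toReal h
  simpa [ENNReal.toReal_pow] using this

theorem enorm_lp_two_sq {ι E : Type*} [NormedAddCommGroup E] (f : lp (fun _ : ι => E) 2) :
    ‖f‖ₑ ^ 2 = ∑' i, ‖f i‖ₑ ^ 2 := by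
  have h := lp.norm_rpow_eq_tsum (p := 2) (by norm_num) f
  simp only [ENNReal.toReal_ofNat, Real.rpow_ofNat] at h
  have hs := memℓp_two_iff.1 (lp.memℓp f)
  simp only [enorm_sq_eq_ofReal]
  rw [h, ENNReal.ofReal_tsum_of_nonneg (fun _ => sq_nonneg _) hs]

variable [TopologicalSpace.SeparableSpace (Lp ℂ 2 μ)]

variable (μ) in
/-- The isometry from `L²(μ × μ)` to the Hilbert–Schmidt operators that sends a kernel to its
integral operator. -/
def kernelIsometry : Lp ℂ 2 (μ.prod μ) →ₗᵢ[ℂ] HS (Lp ℂ 2 μ) where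
  toFun K := ⟨kernelCLM K, by
    have := countable_basisIndex (Lp ℂ 2 μ)
    refine memℓp_two_of_tsum_enorm_lt ?_
    rw [tsum_enorm_kernelCLM_sq]
    simp⟩
  map_add' K L := Subtype.ext (kernelCLM_add K L)
  map_smul' c K := Subtype.ext (kernelCLM_smul c K)
  norm_map' K := by
    have := countable_basisIndex (Lp ℂ 2 μ)
    refine norm_eq_of_enorm_sq_eq ?_
    rw [← tsum_enorm_kernelCLM_sq (stdHilbertBasis (Lp ℂ 2 μ)) K]
    exact enorm_lp_two_sq _

variable (H : Type*) [NormedAddCommGroup H] [InnerProductSpace ℂ H] [CompleteSpace H] in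
/-- `A ↦ (A eᵢ)ᵢ` as an isometry; the norm of `HS H` is induced by it. -/
def toSeqIsometry : HS H →ₗᵢ[ℂ] lp (fun _ : basisIndex H => H) 2 where
  toLinearMap := HS.toSeq H
  norm_map' _ := rfl

/-- The rank-one operators `χ ↦ ⟪eᵢ, χ⟫ ψ` have the kernels `ψ(ξ) conj (eᵢ(η))`, and they account for
the sequences supported at one index, whose span is dense. -/
theorem toSeq_kernelIsometry_surjective :
    Function.Surjective fun K => HS.toSeq (Lp ℂ 2 μ) (kernelIsometry μ K) := by
  classical
  have hU := ((toSeqIsometry (Lp ℂ 2 μ)).comp (kernelIsometry μ)).isometry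
  set R : Submodule ℂ (lp (fun _ : basisIndex (Lp ℂ 2 μ) => Lp ℂ 2 μ) 2) :=
    LinearMap.range ((toSeqIsometry (Lp ℂ 2 μ)).comp (kernelIsometry μ)).toLinearMap with hR
  have hclosed : IsClosed (R : Set (lp (fun _ : basisIndex (Lp ℂ 2 μ) => Lp ℂ 2 μ) 2)) := by
    rw [hR, LinearMap.coe_range]
    exact hU.isClosedEmbedding.isClosed_range
  have hsingle : ∀ i (ψ : Lp ℂ 2 μ), lp.single 2 i ψ ∈ R := by
    intro i ψ
    set e := stdHilbertBasis (Lp ℂ 2 μ)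
    have hK := memLp_two_mul_prod (Lp.memLp ψ) (Lp.memLp (e i)).star
    refine ⟨hK.toLp, lp.ext (funext fun j => ?_)⟩
    change kernelCLM (hK.toLp) (e j) = _
    have h1 : kernelCLM (hK.toLp) (e j) = (inner ℂ (e i) (e j) : ℂ) • ψ := by
      refine Lp.ext ?_
      filter_upwards [kernelCLM_apply_ae hK.toLp (e j), Lp.coeFn_smul (inner ℂ (e i) (e j) : ℂ) ψ,
        Measure.ae_ae_of_ae_prod hK.coeFn_toLp] with ξ h1 h2 h3
      rw [h1, h2, Pi.smul_apply, smul_eq_mul, L2.inner_def, mul_comm, ← integral_const_mul]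
      refine integral_congr_ae ?_
      filter_upwards [h3] with η hη
      rw [hη]
      simp only [Pi.star_apply, RCLike.star_def, RCLike.inner_apply]
      ring
    rw [h1, orthonormal_iff_ite.1 e.orthonormal i j]
    by_cases hij : i = j
    · subst hij; simp
    · rw [if_neg hij, zero_smul, lp.single_apply_ne _ _ _ (Ne.symm hij)]
  intro f
  have hf : f ∈ R := by
    have hs := lp.hasSum_single (p := 2) (by norm_num) f
    exact hclosed.mem_of_tendsto hs (Eventually.of_forall fun s => R.sum_mem fun i _ => hsingle i _)
  exact hf

theorem kernelIsometry_surjective : Function.Surjective (kernelIsometry μ) := fun A => by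
  obtain ⟨K, hK⟩ := toSeq_kernelIsometry_surjective (HS.toSeq _ A)
  exact ⟨K, HS.toSeq_injective _ hK⟩

variable (μ) in
/-- The unitary identification of `L²(μ × μ)` with the Hilbert–Schmidt operators. -/
def kernelEquiv : Lp ℂ 2 (μ.prod μ) ≃ₗᵢ[ℂ] HS (Lp ℂ 2 μ) :=
  LinearIsometryEquiv.ofSurjective (kernelIsometry μ) kernelIsometry_surjective

theorem kernelEquiv_toCLM (K : Lp ℂ 2 (μ.prod μ)) : (kernelEquiv μ K).toCLM = kernelCLM K := rfl

theorem completeSpace_HS : CompleteSpace (HS (Lp ℂ 2 μ)) :=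
  (completeSpace_congr (e := (kernelEquiv μ).toEquiv)
    (kernelEquiv μ).isometry.isUniformEmbedding).1 inferInstance

end KernelOperator

/-! ### Integral kernels of Hilbert–Schmidt operators on `L²(ℝⁿ)` -/

theorem separableSpace_Lp_two {α : Type*} [MeasurableSpace α]
    [MeasurableSpace.CountablyGenerated α] (μ : Measure α) [SFinite μ] :
    TopologicalSpace.SeparableSpace (Lp ℂ 2 μ) :=
  have : Fact ((2 : ℝ≥0∞) ≠ ∞) := ⟨by norm_num⟩
  inferInstance

instance (n : ℕ) : TopologicalSpace.SeparableSpace (L2R n) := separableSpace_Lp_two _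

instance (n : ℕ) :
    TopologicalSpace.SeparableSpace (Lp ℂ 2 (volume : Measure (Rn n × Rn n))) :=
  separableSpace_Lp_two ((volume : Measure (Rn n)).prod volume)

instance (n : ℕ) : CompleteSpace (HS (L2R n)) := completeSpace_HS

theorem isIntegralKernel_iff {n : ℕ} (A : HS (L2R n))
    (K : Lp ℂ 2 (volume : Measure (Rn n × Rn n))) :
    IsIntegralKernel A.toCLM K ↔ kernelEquiv volume K = A := by
  constructor
  · intro h
    refine Subtype.ext (ContinuousLinearMap.ext fun ψ => ?_)
    exact Lp.ext ((kernelCLM_apply_ae K ψ).trans (h ψ).symm)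
  · rintro rfl ψ
    exact kernelCLM_apply_ae K ψ

theorem integralKernel_eq {n : ℕ} (A : HS (L2R n)) :
    integralKernel A = (kernelEquiv (volume : Measure (Rn n))).symm A := by
  have h : ∃ K, IsIntegralKernel A.toCLM K :=
    ⟨(kernelEquiv volume).symm A, (isIntegralKernel_iff _ _).2 (by simp)⟩
  rw [integralKernel, dif_pos h]
  rw [LinearIsometryEquiv.eq_symm_apply]
  exact (isIntegralKernel_iff A _).1 h.choose_spec

theorem isIntegralKernel_integralKernel {n : ℕ} (A : HS (L2R n)) :
    IsIntegralKernel A.toCLM (integralKernel A) := by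
  rw [isIntegralKernel_iff, integralKernel_eq]
  simp

theorem inner_eq_inner_integralKernel {n : ℕ} (A B : HS (L2R n)) :
    inner ℂ A B = inner ℂ (integralKernel A) (integralKernel B) := by
  rw [integralKernel_eq, integralKernel_eq, LinearIsometryEquiv.inner_map_map]

/-! ### Weak measurability -/

/-- A weakly measurable map into a separable Hilbert space is strongly measurable, being the limit of
its partial sums along a countable Hilbert basis. -/
theorem stronglyMeasurable_of_inner {α H : Type*} [MeasurableSpace α] [NormedAddCommGroup H]
    [InnerProductSpace ℂ H] [CompleteSpace H] [TopologicalSpace.SeparableSpace H] {f : α → H}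
    (hf : ∀ u : H, StronglyMeasurable fun a => (inner ℂ u (f a) : ℂ)) : StronglyMeasurable f := by
  have := countable_basisIndex H
  set b := stdHilbertBasis H
  refine stronglyMeasurable_of_tendsto (atTop : Filter (Finset (basisIndex H)))
    (f := fun s a => ∑ i ∈ s, (inner ℂ (b i) (f a) : ℂ) • b i) (fun s => ?_) ?_
  · exact Finset.stronglyMeasurable_fun_sum s fun i _ => (hf (b i)).smul_const (b i)
  · rw [tendsto_pi_nhds]
    intro a
    simpa [HilbertBasis.repr_apply_apply] using! b.hasSum_repr (f a)

/-! ### Plancherel for integrable, square-integrable functions -/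

section Plancherel

open FourierTransform SchwartzMap

variable {V : Type*} [NormedAddCommGroup V] [InnerProductSpace ℝ V] [FiniteDimensional ℝ V]
  [MeasurableSpace V] [BorelSpace V]

/-- The Fourier integral of an integrable square-integrable function represents its `L²` Fourier
transform: both have the same integrals against test functions. -/
theorem fourier_toLp_ae_eq {f : V → ℂ} (h1 : Integrable f) (h2 : MemLp f 2) :
    (𝓕 (h2.toLp f) : Lp ℂ 2 (volume : Measure V)) =ᵐ[volume] 𝓕 f := by
  have hcont : Continuous (𝓕 f) := VectorFourier.fourierIntegral_continuous
    Real.continuous_fourierChar (by exact continuous_inner) h1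
  refine ae_eq_of_integral_contDiff_smul_eq
    ((Lp.memLp (𝓕 (h2.toLp f))).locallyIntegrable (by norm_num)) hcont.locallyIntegrable ?_
  intro g hg hgc
  have hgc' : HasCompactSupport (fun x => (g x : ℂ)) := hgc.comp_left Complex.ofReal_zero
  have hg' : ContDiff ℝ ((⊤ : ℕ∞) : WithTop ℕ∞) (fun x => (g x : ℂ)) :=
    Complex.ofRealCLM.contDiff.comp hg
  set φ : 𝓢(V, ℂ) := hgc'.toSchwartzMap hg'
  have hφ : ∀ x, φ x = (g x : ℂ) := fun x => rfl
  have e1 : (𝓕 (h2.toLp f : 𝓢'(V, ℂ))) φ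
      = ((𝓕 (h2.toLp f) : Lp ℂ 2 (volume : Measure V)) : 𝓢'(V, ℂ)) φ := by
    rw [Lp.fourier_toTemperedDistribution_eq]
  simp only [TemperedDistribution.fourier_apply, Lp.toTemperedDistribution_apply] at e1
  have e2 : ∫ x, (𝓕 φ) x • f x = ∫ x, φ x • 𝓕 f x := by
    have := VectorFourier.integral_fourierIntegral_smul_eq_flip (L := innerₗ V)
      (f := (φ : V → ℂ)) (g := f) Real.continuous_fourierChar continuous_inner
      (φ.integrable (μ := volume)) h1
    simpa using! this
  have e3 : ∫ x, (𝓕 φ) x • (h2.toLp f) x = ∫ x, (𝓕 φ) x • f x := by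
    refine integral_congr_ae ?_
    filter_upwards [h2.coeFn_toLp] with x hx
    rw [hx]
  rw [e3, e2] at e1
  simp only [hφ] at e1
  simpa using e1.symm

theorem lintegral_fourierInv_sq {f : V → ℂ} (h1 : Integrable f) (h2 : MemLp f 2) :
    ∫⁻ v, ‖𝓕⁻ f v‖ₑ ^ 2 = ∫⁻ v, ‖f v‖ₑ ^ 2 := by
  have e1 : ∫⁻ v, ‖𝓕⁻ f v‖ₑ ^ 2 = ∫⁻ v, ‖𝓕 f v‖ₑ ^ 2 := by
    simp only [Real.fourierInv_eq_fourier_neg]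
    exact lintegral_neg_eq_self (fun v => ‖𝓕 f v‖ₑ ^ 2)
  have e2 : ∫⁻ v, ‖𝓕 f v‖ₑ ^ 2
      = ∫⁻ v, ‖(𝓕 (h2.toLp f) : Lp ℂ 2 (volume : Measure V)) v‖ₑ ^ 2 := by
    refine lintegral_congr_ae ?_
    filter_upwards [fourier_toLp_ae_eq h1 h2] with x hx
    rw [hx]
  rw [e1, e2, ← enorm_Lp_two_sq, ← enorm_toLp_two_sq h2, ← ofReal_norm, ← ofReal_norm,
    Lp.norm_fourier_eq]

end Plancherel

/-- The character `e^{2πi r}`. -/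
def char (r : ℝ) : ℂ := Complex.exp (2 * Real.pi * Complex.I * (r : ℝ))

theorem char_add (r s : ℝ) : char (r + s) = char r * char s := by
  rw [char, char, char, ← Complex.exp_add]
  push_cast
  ring_nf

theorem norm_char (r : ℝ) : ‖char r‖ = 1 := by
  rw [char, show 2 * (Real.pi : ℂ) * Complex.I * (r : ℂ) = ((2 * Real.pi * r : ℝ) : ℂ) * Complex.I
    by push_cast; ring]
  exact Complex.norm_exp_ofReal_mul_I _

theorem conj_char (r : ℝ) : conj (char r) = char (-r) := by
  rw [char, char, ← Complex.exp_conj]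
  congr 1
  simp only [map_mul, Complex.conj_I, Complex.conj_ofReal, Complex.conj_ofNat]
  push_cast
  ring

theorem enorm_char (r : ℝ) : ‖char r‖ₑ = 1 := by
  rw [← ofReal_norm, norm_char, ENNReal.ofReal_one]

theorem char_int (m : ℤ) : char m = 1 := by
  rw [char, show 2 * (Real.pi : ℂ) * Complex.I * ((m : ℝ) : ℂ) = m * (2 * Real.pi * Complex.I) by
    push_cast; ring]
  exact Complex.exp_int_mul_two_pi_mul_I m

theorem char_zero : char 0 = 1 := by simp [char]

@[fun_prop]
theorem continuous_char : Continuous char := by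
  unfold char
  fun_prop

/-- The inverse Fourier integral on `ℝⁿ × ℝ` in product coordinates. -/
def prodFourier {n : ℕ} (h : Rn n × ℝ → ℂ) (u : Rn n) (lam : ℝ) : ℂ :=
  ∫ p : Rn n × ℝ, char (inner ℝ p.1 u + lam * p.2) * h p

theorem lintegral_prodFourier_sq {n : ℕ} {h : Rn n × ℝ → ℂ} (h1 : Integrable h) (h2 : MemLp h 2) :
    ∫⁻ q : Rn n × ℝ, ‖prodFourier h q.1 q.2‖ₑ ^ 2 = ∫⁻ p, ‖h p‖ₑ ^ 2 := by
  have hp := WithLp.volume_preserving_ofLp (Rn n) ℝ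
  have hemb : MeasurableEmbedding (@WithLp.ofLp 2 (Rn n × ℝ)) :=
    (MeasurableEquiv.toLp 2 (Rn n × ℝ)).symm.measurableEmbedding
  have key := lintegral_fourierInv_sq (V := WithLp 2 (Rn n × ℝ))
    (f := fun v => h v.ofLp) (hp.integrable_comp_of_integrable h1)
    (h2.comp_measurePreserving hp)
  rw [← hp.lintegral_comp_emb hemb (fun p => ‖h p‖ₑ ^ 2), ← key,
    ← hp.lintegral_comp_emb hemb (fun q => ‖prodFourier h q.1 q.2‖ₑ ^ 2)]
  refine lintegral_congr fun v => ?_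
  rw [Real.fourierInv_eq', prodFourier, ← hp.integral_comp hemb]
  congr 3
  ext w
  rw [smul_eq_mul, char]
  congr 2
  simp only [WithLp.prod_inner_apply, RCLike.inner_apply, conj_trivial]
  push_cast
  ring

/-! ### The kernel of the group Fourier transform -/

instance (n : ℕ) : SigmaFinite (volume : Measure (Heis n)) :=
  inferInstanceAs (SigmaFinite (volume : Measure (Rn n × Rn n × ℝ)))

/-- The coordinate change `(y, (x, t)) ↦ (x, (y, t))`. -/
def moveSecondFirst (α β γ : Type*) [MeasurableSpace α] [MeasurableSpace β] [MeasurableSpace γ] :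
    α × (β × γ) ≃ᵐ β × (α × γ) :=
  MeasurableEquiv.prodAssoc.symm.trans
    ((MeasurableEquiv.prodCongr MeasurableEquiv.prodComm (MeasurableEquiv.refl γ)).trans
      MeasurableEquiv.prodAssoc)

theorem measurePreserving_moveSecondFirst {α β γ : Type*} [MeasurableSpace α] [MeasurableSpace β]
    [MeasurableSpace γ] (μ : Measure α) (ν : Measure β) (ρ : Measure γ) [SigmaFinite μ]
    [SigmaFinite ν] [SigmaFinite ρ] :
    MeasurePreserving (moveSecondFirst α β γ) (μ.prod (ν.prod ρ)) (ν.prod (μ.prod ρ)) :=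
  ((measurePreserving_prodAssoc μ ν ρ).symm _).trans
    ((Measure.measurePreserving_swap.prod (MeasurePreserving.id ρ)).trans
      (measurePreserving_prodAssoc ν μ ρ))

section Slices

variable {n : ℕ} {f : Rn n × Rn n × ℝ → ℂ}

theorem ae_integrable_slice (hf : Integrable f) :
    ∀ᵐ y : Rn n, Integrable fun p : Rn n × ℝ => f (p.1, y, p.2) :=
  ((measurePreserving_moveSecondFirst volume volume volume).integrable_comp_of_integrable
    (g := f) hf).prod_right_ae

theorem ae_memLp_slice (hf : MemLp f 2) :
    ∀ᵐ y : Rn n, MemLp (fun p : Rn n × ℝ => f (p.1, y, p.2)) 2 :=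
  ae_memLp_two_slice (hf.comp_measurePreserving
    (measurePreserving_moveSecondFirst volume volume volume))

variable (f) in
/-- The kernel `K^λ(ξ, η) = ∫∫ f(x, η - ξ, t) e^{2πiλ(t + x·(ξ+η)/2)} dx dt` of `f̂(λ)`. -/
def fourierKernel (lam : ℝ) (ξ η : Rn n) : ℂ :=
  prodFourier (fun p => f (p.1, η - ξ, p.2)) ((lam / 2) • (ξ + η)) lam

theorem stronglyMeasurable_prodFourier_slice (hf : StronglyMeasurable f) :
    StronglyMeasurable fun q : (Rn n × Rn n) × ℝ =>
      prodFourier (fun p => f (p.1, q.1.2, p.2)) q.1.1 q.2 := by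
  refine StronglyMeasurable.integral_prod_right (ν := (volume : Measure (Rn n × ℝ)))
    (f := fun (q : (Rn n × Rn n) × ℝ) (p : Rn n × ℝ) =>
      char (inner ℝ p.1 q.1.1 + q.2 * p.2) * f (p.1, q.1.2, p.2)) ?_
  refine StronglyMeasurable.mul (Continuous.stronglyMeasurable ?_) (hf.comp_measurable ?_)
  · fun_prop
  · fun_prop

theorem stronglyMeasurable_fourierKernel (hf : StronglyMeasurable f) :
    StronglyMeasurable fun q : ℝ × (Rn n × Rn n) => fourierKernel f q.1 q.2.1 q.2.2 :=
  (stronglyMeasurable_prodFourier_slice hf).comp_measurable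
    (g := fun q : ℝ × (Rn n × Rn n) => (((q.1 / 2) • (q.2.1 + q.2.2), q.2.2 - q.2.1), q.1))
    (by fun_prop)

theorem lintegral_smul_eq {lam : ℝ} (hlam : lam ≠ 0) {F : Rn n → ℝ≥0∞} (hF : Measurable F) :
    ENNReal.ofReal (|lam| ^ n) * ∫⁻ u, F (lam • u) = ∫⁻ u, F u := by
  have h := Measure.map_addHaar_smul (volume : Measure (Rn n)) hlam
  rw [← lintegral_map (g := fun u : Rn n => lam • u) hF (by fun_prop), h,
    lintegral_smul_measure, smul_eq_mul, ← mul_assoc, ← ENNReal.ofReal_mul (by positivity),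
    finrank_euclideanSpace_fin, abs_inv, abs_pow,
    mul_inv_cancel₀ (pow_ne_zero _ (abs_ne_zero.2 hlam)), ENNReal.ofReal_one, one_mul]

/-- The change of variables `(u, y) = (λ(ξ + η)/2, η - ξ)` has Jacobian `|λ|ⁿ`. -/
theorem lintegral_weyl_coordinates {lam : ℝ} (hlam : lam ≠ 0) {G : Rn n × Rn n → ℝ≥0∞}
    (hG : Measurable G) :
    ENNReal.ofReal (|lam| ^ n) * ∫⁻ p : Rn n × Rn n, G ((lam / 2) • (p.1 + p.2), p.2 - p.1)
      = ∫⁻ q : Rn n × Rn n, G q := by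
  rw [Measure.volume_eq_prod, lintegral_prod _ (by fun_prop), lintegral_prod_symm _ (by fun_prop)]
  have h1 : ∀ ξ : Rn n, ∫⁻ η, G ((lam / 2) • (ξ + η), η - ξ)
      = ∫⁻ y, G (lam • (ξ + (1 / 2 : ℝ) • y), y) := fun ξ => by
    rw [← lintegral_add_left_eq_self _ ξ]
    refine lintegral_congr fun y => ?_
    congr 2
    · module
    · abel
  simp only [h1]
  rw [lintegral_lintegral_swap (by fun_prop), ← lintegral_const_mul' _ _ ENNReal.ofReal_ne_top]
  refine lintegral_congr fun y => ?_
  rw [lintegral_add_right_eq_self (fun ξ => G (lam • ξ, y)),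
    lintegral_smul_eq hlam (F := fun u => G (u, y)) (by fun_prop)]

theorem lintegral_weyl_coordinates_family {g : (Rn n × Rn n) × ℝ → ℝ≥0∞} (hg : Measurable g) :
    ∫⁻ lam : ℝ, ENNReal.ofReal (|lam| ^ n) *
      ∫⁻ p : Rn n × Rn n, g (((lam / 2) • (p.1 + p.2), p.2 - p.1), lam)
      = ∫⁻ y : Rn n, ∫⁻ q : Rn n × ℝ, g ((q.1, y), q.2) := by
  calc _ = ∫⁻ lam : ℝ, ∫⁻ q : Rn n × Rn n, g (q, lam) := by
        refine lintegral_congr_ae ?_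
        filter_upwards [compl_mem_ae_iff.2 (measure_singleton (0 : ℝ))] with lam hlam
        exact lintegral_weyl_coordinates (G := fun q => g (q, lam)) hlam (by fun_prop)
    _ = ∫⁻ lam : ℝ, ∫⁻ y : Rn n, ∫⁻ u : Rn n, g ((u, y), lam) := by
        refine lintegral_congr fun lam => ?_
        rw [Measure.volume_eq_prod, lintegral_prod_symm _ (by fun_prop)]
    _ = ∫⁻ y : Rn n, ∫⁻ lam : ℝ, ∫⁻ u : Rn n, g ((u, y), lam) := by
        refine lintegral_lintegral_swap (Measurable.aemeasurable ?_)
        exact Measurable.lintegral_prod_right (ν := (volume : Measure (Rn n)))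
          (f := fun (p : ℝ × Rn n) u => g ((u, p.2), p.1)) (by fun_prop)
    _ = _ := by
        refine lintegral_congr fun y => ?_
        rw [Measure.volume_eq_prod, lintegral_prod_symm _ (by fun_prop)]

theorem lintegral_moveSecondFirst {g : Rn n × Rn n × ℝ → ℝ≥0∞} (hg : Measurable g) :
    ∫⁻ X, g X = ∫⁻ y : Rn n, ∫⁻ p : Rn n × ℝ, g (p.1, y, p.2) := by
  have hσ := measurePreserving_moveSecondFirst (volume : Measure (Rn n)) (volume : Measure (Rn n))
    (volume : Measure ℝ)
  calc ∫⁻ X, g X = ∫⁻ Y, g (moveSecondFirst _ _ _ Y)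
        ∂((volume : Measure (Rn n)).prod ((volume : Measure (Rn n)).prod (volume : Measure ℝ))) :=
        (hσ.lintegral_comp hg).symm
    _ = _ := lintegral_prod _ (hg.comp (MeasurableEquiv.measurable _)).aemeasurable

/-- Plancherel for the group Fourier transform, in terms of kernels. -/
theorem lintegral_fourierKernel_sq (hf : StronglyMeasurable f) (h1 : Integrable f)
    (h2 : MemLp f 2) :
    ∫⁻ lam : ℝ, ENNReal.ofReal (|lam| ^ n) *
      ∫⁻ p : Rn n × Rn n, ‖fourierKernel f lam p.1 p.2‖ₑ ^ 2 = ∫⁻ X, ‖f X‖ₑ ^ 2 := by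
  rw [lintegral_moveSecondFirst (hf.measurable.enorm.pow_const 2)]
  refine (lintegral_weyl_coordinates_family
    (g := fun q => ‖prodFourier (fun p => f (p.1, q.1.2, p.2)) q.1.1 q.2‖ₑ ^ 2)
    ((stronglyMeasurable_prodFourier_slice hf).measurable.enorm.pow_const 2)).trans ?_
  refine lintegral_congr_ae ?_
  filter_upwards [ae_integrable_slice h1, ae_memLp_slice h2] with y hy1 hy2
  exact lintegral_prodFourier_sq hy1 hy2

open Classical in
variable (f) in
/-- The kernel of `f̂(λ)` as an element of `L²(ℝⁿ × ℝⁿ)`, set to `0` where it is not square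
integrable. -/
def fourierKernelLp (lam : ℝ) : Lp ℂ 2 (volume : Measure (Rn n × Rn n)) :=
  if h : MemLp (fun p : Rn n × Rn n => fourierKernel f lam p.1 p.2) 2 then h.toLp else 0

theorem stronglyMeasurable_fourierKernelLp (hf : StronglyMeasurable f) :
    StronglyMeasurable (fourierKernelLp f) := by
  classical
  have hK := stronglyMeasurable_fourierKernel hf
  refine stronglyMeasurable_of_inner fun E => ?_
  have hset : MeasurableSet
      {lam | MemLp (fun p : Rn n × Rn n => fourierKernel f lam p.1 p.2) 2} := by
    have hs : {lam | MemLp (fun p : Rn n × Rn n => fourierKernel f lam p.1 p.2) 2}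
        = {lam | ∫⁻ p : Rn n × Rn n, ‖fourierKernel f lam p.1 p.2‖ₑ ^ 2 < ∞} := by
      ext lam
      rw [Set.mem_ofPred_eq, Set.mem_ofPred_eq, memLp_two_iff, and_iff_right]
      exact (hK.comp_measurable measurable_prodMk_left).aestronglyMeasurable
    rw [hs]
    refine measurableSet_lt ?_ measurable_const
    exact Measurable.lintegral_prod_right (hK.measurable.enorm.pow_const 2)
  have e : (fun lam => (inner ℂ E (fourierKernelLp f lam) : ℂ)) = Set.indicator
      {lam | MemLp (fun p : Rn n × Rn n => fourierKernel f lam p.1 p.2) 2}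
      (fun lam => ∫ p : Rn n × Rn n, fourierKernel f lam p.1 p.2 * conj (E p)) := by
    ext lam
    by_cases h : MemLp (fun p : Rn n × Rn n => fourierKernel f lam p.1 p.2) 2
    · rw [Set.indicator_of_mem (by exact h), fourierKernelLp, dif_pos h, L2.inner_def]
      refine integral_congr_ae ?_
      filter_upwards [h.coeFn_toLp] with p hp
      rw [hp, RCLike.inner_apply]
    · rw [Set.indicator_of_notMem (by exact h), fourierKernelLp, dif_neg h, inner_zero_right]
  rw [e]
  refine StronglyMeasurable.indicator ?_ hset
  refine StronglyMeasurable.integral_prod_right (ν := (volume : Measure (Rn n × Rn n)))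
    (f := fun lam p => fourierKernel f lam p.1 p.2 * conj (E p)) (hK.mul ?_)
  exact Complex.continuous_conj.comp_stronglyMeasurable
    ((Lp.stronglyMeasurable E).comp_measurable measurable_snd)

theorem ae_memLp_fourierKernel (hf : StronglyMeasurable f) (h1 : Integrable f)
    (h2 : MemLp f 2) :
    ∀ᵐ lam : ℝ, MemLp (fun p : Rn n × Rn n => fourierKernel f lam p.1 p.2) 2 := by
  have hK := stronglyMeasurable_fourierKernel hf
  have h := lintegral_fourierKernel_sq hf h1 h2
  have hm : Measurable fun lam => ENNReal.ofReal (|lam| ^ n) *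
      ∫⁻ p : Rn n × Rn n, ‖fourierKernel f lam p.1 p.2‖ₑ ^ 2 :=
    (by fun_prop : Measurable fun lam : ℝ => ENNReal.ofReal (|lam| ^ n)).mul
      (Measurable.lintegral_prod_right (hK.measurable.enorm.pow_const 2))
  have hlt := ae_lt_top hm (h.trans_ne (memLp_two_iff.1 h2).2.ne)
  filter_upwards [hlt, compl_mem_ae_iff.2 (measure_singleton (0 : ℝ))] with lam hl h0
  refine memLp_two_iff.2
    ⟨(hK.comp_measurable measurable_prodMk_left).aestronglyMeasurable, ?_⟩
  refine lt_of_le_of_ne le_top fun htop => ?_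
  rw [htop, ENNReal.mul_top] at hl
  · exact absurd hl (lt_irrefl _)
  · have : lam ≠ 0 := h0
    exact (ENNReal.ofReal_pos.2 (pow_pos (abs_pos.2 this) n)).ne'

end Slices

/-! ### The Schrödinger representations -/

section Schrodinger

variable {n : ℕ}

/-- The function representing `π_λ(X) ψ`. -/
def schrodingerFun (lam : ℝ) (X : Heis n) (ψ : Rn n → ℂ) (ξ : Rn n) : ℂ :=
  char (lam * X.t) * char (lam * (inner ℝ X.x ξ + (1 / 2) * inner ℝ X.x X.y)) * ψ (ξ + X.y)

theorem schrodinger_ae_eq (lam : ℝ) (X : Heis n) (ψ : L2R n) :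
    schrodinger lam X ψ =ᵐ[volume] schrodingerFun lam X ψ :=
  (memLp_schrodinger lam X ψ).coeFn_toLp

theorem ae_comp_add_right {p : Rn n → Prop} (y : Rn n) (h : ∀ᵐ ξ, p ξ) : ∀ᵐ ξ, p (ξ + y) :=
  (measurePreserving_add_right volume y).quasiMeasurePreserving.ae h

theorem enorm_schrodingerFun (lam : ℝ) (X : Heis n) (ψ : Rn n → ℂ) (ξ : Rn n) :
    ‖schrodingerFun lam X ψ ξ‖ₑ = ‖ψ (ξ + X.y)‖ₑ := by
  rw [schrodingerFun, enorm_mul, enorm_mul, enorm_char, enorm_char, one_mul, one_mul]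

theorem norm_schrodinger (lam : ℝ) (X : Heis n) (ψ : L2R n) : ‖schrodinger lam X ψ‖ = ‖ψ‖ := by
  refine norm_eq_of_enorm_sq_eq ?_
  rw [enorm_Lp_two_sq, enorm_Lp_two_sq,
    ← lintegral_add_right_eq_self (fun ξ => ‖ψ ξ‖ₑ ^ 2) X.y]
  refine lintegral_congr_ae ?_
  filter_upwards [schrodinger_ae_eq lam X ψ] with ξ hξ
  rw [hξ, enorm_schrodingerFun]

/-- `π_λ(X)` as a linear isometry of `L²(ℝⁿ)`. -/
def schrodingerIsometry (lam : ℝ) (X : Heis n) : L2R n →ₗᵢ[ℂ] L2R n where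
  toFun := schrodinger lam X
  map_add' ψ χ := by
    refine Lp.ext ?_
    filter_upwards [schrodinger_ae_eq lam X (ψ + χ), schrodinger_ae_eq lam X ψ,
      schrodinger_ae_eq lam X χ, Lp.coeFn_add (schrodinger lam X ψ) (schrodinger lam X χ),
      ae_comp_add_right X.y (Lp.coeFn_add ψ χ)] with ξ h1 h2 h3 h4 h5
    rw [h1, h4, Pi.add_apply, h2, h3, schrodingerFun, schrodingerFun, schrodingerFun, h5,
      Pi.add_apply, mul_add]
  map_smul' c ψ := by
    refine Lp.ext ?_
    filter_upwards [schrodinger_ae_eq lam X (c • ψ), schrodinger_ae_eq lam X ψ,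
      Lp.coeFn_smul c (schrodinger lam X ψ),
      ae_comp_add_right X.y (Lp.coeFn_smul c ψ)] with ξ h1 h2 h4 h5
    rw [h1, RingHom.id_apply, h4, Pi.smul_apply, h2, schrodingerFun, schrodingerFun, h5,
      Pi.smul_apply, smul_eq_mul, smul_eq_mul]
    ring
  norm_map' := norm_schrodinger lam X

theorem schrodingerIsometry_apply (lam : ℝ) (X : Heis n) (ψ : L2R n) :
    schrodingerIsometry lam X ψ = schrodinger lam X ψ := rfl

/-- `π_λ` is a homomorphism. -/
theorem schrodinger_mul (lam : ℝ) (X Y : Heis n) (ψ : L2R n) :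
    schrodinger lam (X * Y) ψ = schrodinger lam X (schrodinger lam Y ψ) := by
  refine Lp.ext ?_
  filter_upwards [schrodinger_ae_eq lam (X * Y) ψ,
    schrodinger_ae_eq lam X (schrodinger lam Y ψ),
    ae_comp_add_right X.y (schrodinger_ae_eq lam Y ψ)] with ξ h1 h2 h3
  rw [h1, h2, schrodingerFun, schrodingerFun, h3, schrodingerFun, Heis.mul_y,
    ← char_add, ← char_add, ← char_add, ← mul_assoc, ← char_add, add_assoc ξ X.y Y.y]
  congr 2
  simp only [Heis.mul_x, Heis.mul_t, inner_add_left, inner_add_right]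
  rw [real_inner_comm X.y Y.x]
  ring

theorem stronglyMeasurable_schrodingerFun_mul (ψ χ : L2R n) :
    StronglyMeasurable fun q : (ℝ × (Rn n × Rn n × ℝ)) × Rn n =>
      schrodingerFun q.1.1 (Heis.mk q.1.2.1 q.1.2.2.1 q.1.2.2.2) ψ q.2 * conj (χ q.2) := by
  refine StronglyMeasurable.mul (StronglyMeasurable.mul
    (Continuous.stronglyMeasurable ?_) ((Lp.stronglyMeasurable ψ).comp_measurable ?_)) ?_
  · simp only [Heis.mk_x, Heis.mk_y, Heis.mk_t]
    fun_prop
  · simp only [Heis.mk_y]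
    fun_prop
  · exact Complex.continuous_conj.comp_stronglyMeasurable
      ((Lp.stronglyMeasurable χ).comp_measurable measurable_snd)

theorem inner_schrodinger (lam : ℝ) (X : Heis n) (ψ χ : L2R n) :
    inner ℂ χ (schrodinger lam X ψ) = ∫ ξ, schrodingerFun lam X ψ ξ * conj (χ ξ) := by
  rw [L2.inner_def]
  refine integral_congr_ae ?_
  filter_upwards [schrodinger_ae_eq lam X ψ] with ξ hξ
  rw [hξ, RCLike.inner_apply]

theorem stronglyMeasurable_schrodinger (lam : ℝ) (ψ : L2R n) :
    StronglyMeasurable fun X : Rn n × Rn n × ℝ => schrodinger lam X ψ := by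
  refine stronglyMeasurable_of_inner fun χ => ?_
  have e : (fun X : Rn n × Rn n × ℝ => (inner ℂ χ (schrodinger lam X ψ) : ℂ))
      = fun X => ∫ ξ, schrodingerFun lam X ψ ξ * conj (χ ξ) :=
    funext fun X => inner_schrodinger lam X ψ χ
  rw [e]
  exact StronglyMeasurable.integral_prod_right (ν := (volume : Measure (Rn n)))
    (f := fun (X : Rn n × Rn n × ℝ) ξ => schrodingerFun lam X ψ ξ * conj (χ ξ))
    ((stronglyMeasurable_schrodingerFun_mul ψ χ).comp_measurable
      (g := fun q : (Rn n × Rn n × ℝ) × Rn n => ((lam, q.1), q.2)) (by fun_prop))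

theorem integrable_smul_schrodinger {f : Heis n → ℂ} (hf : Integrable f) (lam : ℝ) (ψ : L2R n) :
    Integrable fun X => f X • schrodinger lam X ψ :=
  (hf.norm.mul_const ‖ψ‖).mono'
    (hf.1.smul (stronglyMeasurable_schrodinger lam ψ).aestronglyMeasurable)
    (ae_of_all _ fun X => by rw [norm_smul, norm_schrodinger])

theorem enorm_ofReal_norm (z : ℂ) : ‖(RCLike.ofReal ‖z‖ : ℂ)‖ₑ = ‖z‖ₑ := by
  rw [← ofReal_norm, ← ofReal_norm]
  simp

/-- The Fubini hypothesis for testing `∫ f(X) π_λ(X) ψ dX` against `χ`. -/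
theorem integrable_smul_schrodingerFun {f : Rn n × Rn n × ℝ → ℂ} (hf : Integrable f) (lam : ℝ)
    (ψ χ : L2R n) :
    Integrable (fun q : (Rn n × Rn n × ℝ) × Rn n =>
      f q.1 * (schrodingerFun lam q.1 ψ q.2 * conj (χ q.2))) (volume.prod volume) := by
  have hm := (stronglyMeasurable_schrodingerFun_mul ψ χ).comp_measurable
      (g := fun q : (Rn n × Rn n × ℝ) × Rn n => ((lam, q.1), q.2)) (by fun_prop)
  have hb : ∀ X : Rn n × Rn n × ℝ, MemLp (schrodingerFun lam X ψ) 2 := fun X =>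
    memLp_schrodinger lam X ψ
  have hm' : AEStronglyMeasurable (fun q : (Rn n × Rn n × ℝ) × Rn n =>
      f q.1 * (schrodingerFun lam q.1 ψ q.2 * conj (χ q.2))) (volume.prod volume) :=
    hf.1.comp_fst.mul hm.aestronglyMeasurable
  refine (integrable_prod_iff hm').2 ⟨?_, ?_⟩
  · refine ae_of_all _ fun X => ?_
    exact ((hb X).integrable_mul (Lp.memLp χ).star).const_mul (f X)
  · refine Integrable.mono' (hf.norm.mul_const (‖ψ‖ * ‖χ‖))
      hm'.norm.integral_prod_right' (ae_of_all _ fun X => ?_)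
    rw [Real.norm_of_nonneg (integral_nonneg fun _ => norm_nonneg _)]
    simp only [norm_mul (f X)]
    rw [integral_const_mul]
    refine mul_le_mul_of_nonneg_left ?_ (norm_nonneg _)
    -- Cauchy–Schwarz for the moduli of `π_λ(X) ψ` and `χ`.
    have e : ∫ ξ, ‖schrodingerFun lam X ψ ξ * conj (χ ξ)‖
        = RCLike.re (inner ℂ ((Lp.memLp χ).norm.ofReal (K := ℂ)).toLp
            ((hb X).norm.ofReal (K := ℂ)).toLp : ℂ) := by
      rw [L2.inner_def]
      have e1 : ∫ ξ, (inner ℂ (((Lp.memLp χ).norm.ofReal (K := ℂ)).toLp _ ξ)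
          (((hb X).norm.ofReal (K := ℂ)).toLp _ ξ) : ℂ)
          = ∫ ξ, ((‖schrodingerFun lam X ψ ξ * conj (χ ξ)‖ : ℝ) : ℂ) := by
        refine integral_congr_ae ?_
        filter_upwards [((Lp.memLp χ).norm.ofReal (K := ℂ)).coeFn_toLp,
          ((hb X).norm.ofReal (K := ℂ)).coeFn_toLp] with ξ h1 h2
        rw [h1, h2]
        simp
      rw [e1, integral_complex_ofReal]
      simp
    rw [e]
    refine (RCLike.re_le_norm _).trans ((norm_inner_le_norm _ _).trans (le_of_eq ?_))
    rw [mul_comm]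
    have n1 : ‖((Lp.memLp χ).norm.ofReal (K := ℂ)).toLp‖ = ‖χ‖ := by
      refine norm_eq_of_enorm_sq_eq ?_
      rw [enorm_toLp_two_sq, enorm_Lp_two_sq]
      simp only [enorm_ofReal_norm]
    have n2 : ‖((hb X).norm.ofReal (K := ℂ)).toLp‖ = ‖ψ‖ := by
      rw [← norm_schrodinger lam X ψ]
      refine norm_eq_of_enorm_sq_eq ?_
      rw [enorm_toLp_two_sq]
      simp only [enorm_ofReal_norm]
      exact (enorm_toLp_two_sq (memLp_schrodinger lam X ψ)).symm
    rw [n1, n2]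

end Schrodinger

/-! ### The group Fourier transform on `L¹ ∩ L²` -/

section FourierIntegrable

variable {n : ℕ} {f : Rn n × Rn n × ℝ → ℂ}

theorem integral_moveSecondFirst {g : Rn n × Rn n × ℝ → ℂ} (hg : Integrable g) :
    ∫ X, g X = ∫ y : Rn n, ∫ p : Rn n × ℝ, g (p.1, y, p.2) := by
  have hσ := measurePreserving_moveSecondFirst (volume : Measure (Rn n)) (volume : Measure (Rn n))
    (volume : Measure ℝ)
  calc ∫ X, g X = ∫ Y, g (moveSecondFirst _ _ _ Y)
        ∂((volume : Measure (Rn n)).prod ((volume : Measure (Rn n)).prod (volume : Measure ℝ))) :=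
        (hσ.integral_comp' g).symm
    _ = _ := integral_prod _ (hσ.integrable_comp_of_integrable hg)

theorem integral_schrodingerFun (lam : ℝ) (ψ : Rn n → ℂ) (ξ : Rn n) (c : ℂ)
    (hi : Integrable fun X : Rn n × Rn n × ℝ => f X * (schrodingerFun lam X ψ ξ * c)) :
    ∫ X : Rn n × Rn n × ℝ, f X * (schrodingerFun lam X ψ ξ * c)
      = (∫ η, fourierKernel f lam ξ η * ψ η) * c := by
  rw [integral_moveSecondFirst hi, ← integral_mul_const,
    ← integral_add_left_eq_self (fun η => fourierKernel f lam ξ η * ψ η * c) ξ]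
  refine integral_congr_ae (ae_of_all _ fun y => ?_)
  simp only
  rw [fourierKernel, prodFourier, ← integral_mul_const, ← integral_mul_const]
  refine integral_congr_ae (ae_of_all _ fun p => ?_)
  simp only
  rw [add_sub_cancel_left]
  change f (p.1, y, p.2) * (char (lam * p.2) * char (lam * (inner ℝ p.1 ξ + 1 / 2 * inner ℝ p.1 y))
    * ψ (ξ + y) * c) = _
  rw [← char_add]
  have : lam * p.2 + lam * (inner ℝ p.1 ξ + 1 / 2 * inner ℝ p.1 y)
      = inner ℝ p.1 ((lam / 2) • (ξ + (ξ + y))) + lam * p.2 := by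
    simp only [inner_add_right, inner_smul_right]
    ring
  rw [this]
  ring

/-- The operator with kernel `K^λ` is `∫ f(X) π_λ(X) dX`. -/
theorem kernelCLM_fourierKernelLp (h1 : Integrable f) {lam : ℝ}
    (hK : MemLp (fun p : Rn n × Rn n => fourierKernel f lam p.1 p.2) 2) (ψ : L2R n) :
    kernelCLM (μ := (volume : Measure (Rn n))) (fourierKernelLp f lam) ψ
      = ∫ X : Heis n, f X • schrodinger lam X ψ := by
  refine ext_inner_left ℂ fun χ => ?_
  have hF := integrable_smul_schrodingerFun h1 lam ψ χ
  rw [← integral_inner (integrable_smul_schrodinger h1 lam ψ) χ]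
  have e1 : ∫ X : Heis n, (inner ℂ χ (f X • schrodinger lam X ψ) : ℂ)
      = ∫ X : Rn n × Rn n × ℝ, ∫ ξ, f X * (schrodingerFun lam X ψ ξ * conj (χ ξ)) := by
    refine integral_congr_ae (ae_of_all _ fun X => ?_)
    simp only
    rw [inner_smul_right, inner_schrodinger, integral_const_mul]
  rw [e1, integral_integral_swap hF, L2.inner_def]
  refine integral_congr_ae ?_
  have hslice : ∀ᵐ ξ : Rn n, ∀ᵐ η : Rn n, fourierKernelLp f lam (ξ, η) = fourierKernel f lam ξ η := by
    refine Measure.ae_ae_of_ae_prod (p := fun p => fourierKernelLp f lam p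
      = fourierKernel f lam p.1 p.2) ?_
    rw [fourierKernelLp, dif_pos hK]
    exact hK.coeFn_toLp
  filter_upwards [hF.prod_left_ae, kernelCLM_apply_ae (fourierKernelLp f lam) ψ, hslice]
    with ξ hi hk hs
  rw [integral_schrodingerFun lam ψ ξ _ hi, RCLike.inner_apply, hk]
  congr 1
  refine integral_congr_ae ?_
  filter_upwards [hs] with η hη
  rw [hη]

end FourierIntegrable

/-! ### The group Fourier transform is an isometry -/

section Plancherel

variable {n : ℕ}

theorem measurable_plancherel_density (n : ℕ) :
    Measurable fun lam : ℝ => ENNReal.ofReal (|lam| ^ n) := by fun_prop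

theorem plancherel_density_ne_zero (n : ℕ) {lam : ℝ} (h : lam ≠ 0) :
    ENNReal.ofReal (|lam| ^ n) ≠ 0 :=
  (ENNReal.ofReal_pos.2 (pow_pos (abs_pos.2 h) n)).ne'

theorem ae_plancherelMeasure_iff {p : ℝ → Prop} :
    (∀ᵐ lam ∂(plancherelMeasure n), p lam) ↔ ∀ᵐ lam, p lam := by
  rw [plancherelMeasure, ae_withDensity_iff (measurable_plancherel_density n)]
  refine ⟨fun h => ?_, fun h => h.mono fun lam hl _ => hl⟩
  filter_upwards [h, compl_mem_ae_iff.2 (measure_singleton (0 : ℝ))] with lam h1 h2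
  exact h1 (plancherel_density_ne_zero n h2)

theorem norm_toCLM_apply_le (A : HS (L2R n)) (ψ : L2R n) : ‖A.toCLM ψ‖ ≤ ‖A‖ * ‖ψ‖ := by
  obtain ⟨K, rfl⟩ := (kernelEquiv (volume : Measure (Rn n))).surjective A
  rw [LinearIsometryEquiv.norm_map, kernelEquiv_toCLM]
  exact ContinuousLinearMap.le_of_opNorm_le _
    (LinearMap.mkContinuous_norm_le _ (norm_nonneg K) _) ψ

/-- `A ↦ A ψ` on the Hilbert–Schmidt operators. -/
def evalCLM (ψ : L2R n) : HS (L2R n) →L[ℂ] L2R n :=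
  LinearMap.mkContinuous
    { toFun := fun A => A.toCLM ψ
      map_add' := fun _ _ => rfl
      map_smul' := fun _ _ => rfl } ‖ψ‖ (fun A => by
    rw [mul_comm]
    exact norm_toCLM_apply_le A ψ)

theorem HS_ext {A B : HS (L2R n)} (h : ∀ ψ, A.toCLM ψ = B.toCLM ψ) : A = B :=
  Subtype.ext (ContinuousLinearMap.ext h)

/-- The Fourier transform of an integrable `f ∈ L²(ℍⁿ)`, as the operator with kernel `K^λ`. -/
def integralFourier (f : L2H n) (lam : ℝ) : HS (L2R n) :=
  kernelEquiv volume (fourierKernelLp (n := n) f lam)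

theorem ae_memLp_fourierKernel_Lp (f : L2H n) (hf : Integrable f) :
    ∀ᵐ lam : ℝ, MemLp (fun p : Rn n × Rn n => fourierKernel f lam p.1 p.2) 2 :=
  ae_memLp_fourierKernel (Lp.stronglyMeasurable f) hf (Lp.memLp f)

theorem stronglyMeasurable_integralFourier (f : L2H n) :
    StronglyMeasurable (integralFourier f) :=
  (kernelEquiv volume).continuous.comp_stronglyMeasurable
    (stronglyMeasurable_fourierKernelLp (n := n) (Lp.stronglyMeasurable f))

theorem lintegral_integralFourier_sq (f : L2H n) (hf : Integrable f) :
    ∫⁻ lam, ‖integralFourier f lam‖ₑ ^ 2 ∂(plancherelMeasure n) = ‖f‖ₑ ^ 2 := by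
  rw [enorm_Lp_two_sq f, plancherelMeasure, lintegral_withDensity_eq_lintegral_mul _
    (measurable_plancherel_density n)
    ((stronglyMeasurable_integralFourier f).enorm.pow_const 2)]
  refine Eq.trans ?_
    (lintegral_fourierKernel_sq (n := n) (Lp.stronglyMeasurable f) hf (Lp.memLp f))
  refine lintegral_congr_ae ?_
  filter_upwards [ae_memLp_fourierKernel_Lp f hf] with lam hlam
  rw [Pi.mul_apply]
  congr 1
  rw [← enorm_toLp_two_sq hlam]
  have h : ‖integralFourier f lam‖ = ‖hlam.toLp‖ :=
    ((kernelEquiv volume).norm_map _).trans (congrArg norm (dif_pos hlam))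
  rw [← ofReal_norm, ← ofReal_norm, h]

theorem memLp_integralFourier (f : L2H n) (hf : Integrable f) :
    MemLp (integralFourier f) 2 (plancherelMeasure n) := by
  refine memLp_two_iff.2 ⟨(stronglyMeasurable_integralFourier f).aestronglyMeasurable, ?_⟩
  rw [lintegral_integralFourier_sq f hf]
  simp

theorem integralFourier_toCLM (f : L2H n) (hf : Integrable f) :
    ∀ᵐ lam, ∀ ψ : L2R n,
      (integralFourier f lam).toCLM ψ = ∫ X : Heis n, f X • schrodinger lam X ψ := by
  filter_upwards [ae_memLp_fourierKernel_Lp f hf] with lam hlam ψ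
  exact kernelCLM_fourierKernelLp hf hlam ψ

theorem toLp_integralFourier_mem_fourierGraph (f : L2H n) (hf : Integrable f) :
    (f, (memLp_integralFourier f hf).toLp) ∈ fourierGraph n := by
  refine ⟨hf, ?_⟩
  have h2 := (ae_plancherelMeasure_iff (n := n)).2 (integralFourier_toCLM f hf)
  filter_upwards [(memLp_integralFourier f hf).coeFn_toLp, h2] with lam e1 e2
  simpa only [e1] using e2

theorem eq_of_mem_fourierGraph {f : L2H n} {F F' : L2HS n} (h : (f, F) ∈ fourierGraph n)
    (h' : (f, F') ∈ fourierGraph n) : F = F' := by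
  refine Lp.ext ?_
  filter_upwards [h.2, h'.2] with lam e e'
  exact HS_ext fun ψ => (e ψ).trans (e' ψ).symm

theorem norm_eq_of_mem_fourierGraph {p : L2H n × L2HS n} (hp : p ∈ fourierGraph n) :
    ‖p.2‖ = ‖p.1‖ := by
  rw [eq_of_mem_fourierGraph (F := p.2) hp (toLp_integralFourier_mem_fourierGraph p.1 hp.1)]
  refine norm_eq_of_enorm_sq_eq ?_
  rw [enorm_toLp_two_sq, lintegral_integralFourier_sq p.1 hp.1]

/-- The graph of the Fourier transform on `L¹ ∩ L²` as a linear subspace. -/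
def fourierGraphSubmodule (n : ℕ) : Submodule ℂ (L2H n × L2HS n) where
  carrier := fourierGraph n
  zero_mem' := by
    refine ⟨(integrable_zero (Heis n) ℂ volume).congr (Lp.coeFn_zero ℂ 2 volume).symm, ?_⟩
    filter_upwards [Lp.coeFn_zero (HS (L2R n)) 2 (plancherelMeasure n)] with lam h1 ψ
    have h2 : ∫ X : Heis n, (0 : L2H n) X • schrodinger lam X ψ = 0 := by
      rw [← integral_zero (Heis n) (L2R n)]
      refine integral_congr_ae ?_
      filter_upwards [Lp.coeFn_zero ℂ 2 (volume : Measure (Heis n))] with X hX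
      rw [hX, Pi.zero_apply, zero_smul]
    rw [Prod.fst_zero, Prod.snd_zero, h1, h2]
    rfl
  add_mem' := by
    rintro ⟨f, F⟩ ⟨g, G⟩ ⟨hf, hF⟩ ⟨hg, hG⟩
    refine ⟨(hf.add hg).congr (Lp.coeFn_add f g).symm, ?_⟩
    filter_upwards [hF, hG, Lp.coeFn_add F G] with lam h1 h2 h3 ψ
    have h4 : ∫ X : Heis n, (f + g) X • schrodinger lam X ψ
        = (∫ X : Heis n, f X • schrodinger lam X ψ) + ∫ X : Heis n, g X • schrodinger lam X ψ := by
      rw [← integral_add (integrable_smul_schrodinger hf lam ψ)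
        (integrable_smul_schrodinger hg lam ψ)]
      refine integral_congr_ae ?_
      filter_upwards [Lp.coeFn_add f g] with X hX
      rw [hX, Pi.add_apply, add_smul]
    rw [Prod.fst_add, Prod.snd_add, h3, h4, ← h1 ψ, ← h2 ψ]
    rfl
  smul_mem' := by
    rintro c ⟨f, F⟩ ⟨hf, hF⟩
    refine ⟨(hf.smul c).congr (Lp.coeFn_smul c f).symm, ?_⟩
    filter_upwards [hF, Lp.coeFn_smul c F] with lam h1 h3 ψ
    have h4 : ∫ X : Heis n, (c • f) X • schrodinger lam X ψ
        = c • ∫ X : Heis n, f X • schrodinger lam X ψ := by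
      rw [← integral_smul]
      refine integral_congr_ae ?_
      filter_upwards [Lp.coeFn_smul c f] with X hX
      rw [hX, Pi.smul_apply, smul_assoc]
    rw [Prod.smul_fst, Prod.smul_snd, h3, h4, ← h1 ψ]
    rfl

theorem norm_eq_of_mem_closure {p : L2H n × L2HS n}
    (hp : p ∈ (fourierGraphSubmodule n).topologicalClosure) : ‖p.2‖ = ‖p.1‖ :=
  closure_minimal (s := fourierGraph n) (t := {p | ‖p.2‖ = ‖p.1‖})
    (fun _ h => norm_eq_of_mem_fourierGraph h)
    (isClosed_eq (by fun_prop) (by fun_prop)) hp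

theorem dense_integrable (n : ℕ) : Dense {f : L2H n | Integrable f} := by
  refine (Lp.simpleFunc.dense (E := ℂ) (p := 2) (μ := (volume : Measure (Heis n)))
    (by norm_num)).mono fun f hf => ?_
  have e := Lp.simpleFunc.toSimpleFunc_eq_toFun (⟨f, hf⟩ : Lp.simpleFunc ℂ 2 _)
  refine Integrable.congr ?_ e
  exact (SimpleFunc.memLp_iff_integrable (by norm_num) (by norm_num)).1
    (Lp.simpleFunc.memLp (⟨f, hf⟩ : Lp.simpleFunc ℂ 2 _))

/-- The first projection from the closed graph is an isometry with dense range, hence onto. -/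
theorem exists_mem_closure (f : L2H n) :
    ∃ F : L2HS n, (f, F) ∈ (fourierGraphSubmodule n).topologicalClosure := by
  let j : (fourierGraphSubmodule n).topologicalClosure →ₗᵢ[ℂ] L2H n :=
    { toLinearMap := (LinearMap.fst ℂ (L2H n) (L2HS n)).comp
        (fourierGraphSubmodule n).topologicalClosure.subtype
      norm_map' := fun p => by
        have h := norm_eq_of_mem_closure p.2
        change ‖p.1.1‖ = ‖p.1‖
        rw [Prod.norm_def, h, max_self] }
  have : CompleteSpace (fourierGraphSubmodule n).topologicalClosure :=
    (fourierGraphSubmodule n).isClosed_topologicalClosure.completeSpace_coe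
  have hcl : IsClosed (Set.range j) := j.isometry.isClosedEmbedding.isClosed_range
  have hd : Dense (Set.range j) := (dense_integrable n).mono fun g hg =>
    ⟨⟨_, subset_closure (toLp_integralFourier_mem_fourierGraph g hg)⟩, rfl⟩
  obtain ⟨p, hp⟩ : f ∈ Set.range j := by
    rw [← hcl.closure_eq]
    exact hd f
  exact ⟨p.1.2, hp ▸ p.2⟩

theorem mem_closure_groupFourier (f : L2H n) :
    (f, groupFourier f) ∈ (fourierGraphSubmodule n).topologicalClosure := by
  have h : ∃ F : L2HS n, (f, F) ∈ closure (fourierGraph n) := exists_mem_closure f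
  rw [groupFourier, dif_pos h]
  exact h.choose_spec

theorem groupFourier_eq {f : L2H n} {F : L2HS n}
    (h : (f, F) ∈ (fourierGraphSubmodule n).topologicalClosure) : groupFourier f = F := by
  have h1 := norm_eq_of_mem_closure (Submodule.sub_mem _ (mem_closure_groupFourier f) h)
  simp only [Prod.fst_sub, Prod.snd_sub, sub_self, norm_zero, norm_eq_zero] at h1
  exact sub_eq_zero.1 h1

theorem groupFourier_add (f g : L2H n) :
    groupFourier (f + g) = groupFourier f + groupFourier g := by
  have h := Submodule.add_mem _ (mem_closure_groupFourier f) (mem_closure_groupFourier g)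
  rw [Prod.mk_add_mk] at h
  exact groupFourier_eq h

theorem groupFourier_smul (c : ℂ) (f : L2H n) : groupFourier (c • f) = c • groupFourier f := by
  have h := Submodule.smul_mem _ c (mem_closure_groupFourier f)
  rw [Prod.smul_mk] at h
  exact groupFourier_eq h

theorem norm_groupFourier (f : L2H n) : ‖groupFourier f‖ = ‖f‖ := by
  have h := norm_eq_of_mem_closure (mem_closure_groupFourier f)
  simpa only using h

/-- Plancherel: the group Fourier transform as a linear isometry. -/
def groupFourierIsometry (n : ℕ) : L2H n →ₗᵢ[ℂ] L2HS n where
  toFun := groupFourier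
  map_add' := groupFourier_add
  map_smul' := groupFourier_smul
  norm_map' := norm_groupFourier

theorem groupFourierIsometry_apply (f : L2H n) : groupFourierIsometry n f = groupFourier f := rfl

theorem groupFourier_toCLM_of_integrable (f : L2H n) (hf : Integrable f) :
    ∀ᵐ lam, ∀ ψ : L2R n,
      (groupFourier f lam).toCLM ψ = ∫ X : Heis n, f X • schrodinger lam X ψ := by
  rw [groupFourier_eq (subset_closure (toLp_integralFourier_mem_fourierGraph f hf))]
  exact ae_plancherelMeasure_iff.1 (toLp_integralFourier_mem_fourierGraph f hf).2

end Plancherel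

/-! ### Covariance under left translation -/

section Covariance

variable {n : ℕ}

/-- Left multiplication on `ℍⁿ` as a measurable equivalence. -/
def mulLeftEquiv (g : Heis n) : Heis n ≃ᵐ Heis n where
  toEquiv := Equiv.mulLeft g
  measurable_toFun := (measurePreserving_mul_left g).measurable
  measurable_invFun := (measurePreserving_mul_left g⁻¹).measurable

theorem leftTranslate_ae_eq (g : Heis n) (f : L2H n) :
    leftTranslate g f =ᵐ[volume] fun X => f (g⁻¹ * X) :=
  Lp.coeFn_compMeasurePreserving f (measurePreserving_mul_left g⁻¹)

/-- Left translation as a linear isometry of `L²(ℍⁿ)`. -/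
def leftTranslateIsometry (g : Heis n) : L2H n →ₗᵢ[ℂ] L2H n :=
  Lp.compMeasurePreservingₗᵢ ℂ _ (measurePreserving_mul_left g⁻¹)

theorem leftTranslateIsometry_apply (g : Heis n) (f : L2H n) :
    leftTranslateIsometry g f = leftTranslate g f := rfl

theorem leftTranslate_mul (g h : Heis n) (f : L2H n) :
    leftTranslate (g * h) f = leftTranslate g (leftTranslate h f) := by
  refine Lp.ext ?_
  filter_upwards [leftTranslate_ae_eq (g * h) f, leftTranslate_ae_eq g (leftTranslate h f),
    (measurePreserving_mul_left g⁻¹).quasiMeasurePreserving.ae (leftTranslate_ae_eq h f)]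
    with X h1 h2 h3
  rw [h1, h2, h3, mul_inv_rev, mul_assoc]

theorem leftTranslate_one (f : L2H n) : leftTranslate 1 f = f := by
  refine Lp.ext ?_
  filter_upwards [leftTranslate_ae_eq 1 f] with X h1
  rw [h1, inv_one, one_mul]

theorem groupFourier_leftTranslate_of_integrable (g : Heis n) (f : L2H n) (hf : Integrable f) :
    ∀ᵐ lam, ∀ ψ : L2R n, (groupFourier (leftTranslate g f) lam).toCLM ψ
      = schrodinger lam g ((groupFourier f lam).toCLM ψ) := by
  have hg : Integrable (leftTranslate g f) :=
    ((measurePreserving_mul_left g⁻¹).integrable_comp_of_integrable hf).congr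
      (leftTranslate_ae_eq g f).symm
  filter_upwards [groupFourier_toCLM_of_integrable f hf,
    groupFourier_toCLM_of_integrable _ hg] with lam h1 h2 ψ
  rw [h1, h2, ← schrodingerIsometry_apply]
  have e1 : ∫ X : Heis n, leftTranslate g f X • schrodinger lam X ψ
      = ∫ X : Heis n, f (g⁻¹ * X) • schrodinger lam X ψ := by
    refine integral_congr_ae ?_
    filter_upwards [leftTranslate_ae_eq g f] with X hX
    rw [hX]
  have e2 : ∫ X : Heis n, f (g⁻¹ * X) • schrodinger lam X ψ
      = ∫ X : Heis n, f X • schrodinger lam (g * X) ψ := by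
    rw [← (measurePreserving_mul_left g).integral_comp (mulLeftEquiv g).measurableEmbedding]
    simp only [inv_mul_cancel_left]
  rw [e1, e2]
  refine Eq.trans ?_ ((schrodingerIsometry lam g).toContinuousLinearMap.integral_comp_comm
    (integrable_smul_schrodinger hf lam ψ))
  refine integral_congr_ae (ae_of_all _ fun X => ?_)
  simp only [schrodinger_mul]
  exact ((schrodingerIsometry lam g).map_smul _ _).symm

/-- `(L_g f)^(λ) = π_λ(g) f̂(λ)`; from `L¹ ∩ L²` this passes to `L²` along a subsequence that
converges almost everywhere on the Fourier side. -/
theorem groupFourier_leftTranslate (g : Heis n) (f : L2H n) :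
    ∀ᵐ lam, ∀ ψ : L2R n, (groupFourier (leftTranslate g f) lam).toCLM ψ
      = schrodinger lam g ((groupFourier f lam).toCLM ψ) := by
  obtain ⟨u, hu, hlim⟩ := mem_closure_iff_seq_limit.1 (dense_integrable n f)
  have h1 : Tendsto (fun k => groupFourier (u k)) atTop (𝓝 (groupFourier f)) :=
    ((groupFourierIsometry n).continuous.tendsto f).comp hlim
  obtain ⟨s, hs, hs'⟩ := (tendstoInMeasure_of_tendsto_Lp h1).exists_seq_tendsto_ae
  have h2 : Tendsto (fun k => groupFourier (leftTranslate g (u (s k)))) atTop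
      (𝓝 (groupFourier (leftTranslate g f))) :=
    (((groupFourierIsometry n).continuous.comp (leftTranslateIsometry g).continuous).tendsto
      f).comp (hlim.comp hs.tendsto_atTop)
  obtain ⟨r, hr, hr'⟩ := (tendstoInMeasure_of_tendsto_Lp h2).exists_seq_tendsto_ae
  have h3 : ∀ᵐ lam, ∀ k, ∀ ψ : L2R n, (groupFourier (leftTranslate g (u k)) lam).toCLM ψ
      = schrodinger lam g ((groupFourier (u k) lam).toCLM ψ) :=
    ae_all_iff.2 fun k => groupFourier_leftTranslate_of_integrable g (u k) (hu k)
  filter_upwards [h3, ae_plancherelMeasure_iff.1 hs', ae_plancherelMeasure_iff.1 hr']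
    with lam e1 e2 e3 ψ
  have l1 := ((evalCLM ψ).continuous.tendsto _).comp e3
  have l2 := ((schrodingerIsometry lam g).continuous.tendsto _).comp
    (((evalCLM ψ).continuous.tendsto _).comp (e2.comp hr.tendsto_atTop))
  refine tendsto_nhds_unique l1 (l2.congr fun k => ?_)
  exact (e1 (s (r k)) ψ).symm

end Covariance

/-! ### Periodization over `ℤ` and Fourier coefficients on `(0, 1]` -/

section Periodization

theorem ae_comp_add_int {p : ℝ → Prop} (h : ∀ᵐ lam, p lam) :
    ∀ᵐ lam ∂(volume.restrict (Set.Ioc (0 : ℝ) 1)), ∀ r : ℤ, p (lam + r) :=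
  ae_restrict_of_ae (ae_all_iff.2 fun r : ℤ =>
    (measurePreserving_add_right volume (r : ℝ)).quasiMeasurePreserving.ae h)

theorem preimage_add_int_Ioc (r : ℤ) :
    (fun lam : ℝ => lam + r) ⁻¹' Set.Ioc (r : ℝ) (r + 1) = Set.Ioc 0 1 := by
  ext lam
  simp [add_comm (r : ℝ) 1]

theorem setLIntegral_Ioc_tsum {h : ℝ → ℝ≥0∞} (hm : AEMeasurable h) :
    ∫⁻ lam in Set.Ioc (0 : ℝ) 1, ∑' r : ℤ, h (lam + r) = ∫⁻ lam, h lam := by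
  have hs (r : ℤ) : AEMeasurable (fun lam : ℝ => h (lam + r))
      (volume.restrict (Set.Ioc (0 : ℝ) 1)) :=
    (hm.comp_quasiMeasurePreserving
      (measurePreserving_add_right volume (r : ℝ)).quasiMeasurePreserving).restrict
  rw [lintegral_tsum hs, ← setLIntegral_univ h, ← iUnion_Ioc_intCast ℝ,
    lintegral_iUnion (fun r => measurableSet_Ioc) (Set.pairwise_disjoint_Ioc_intCast ℝ)]
  refine tsum_congr fun r => ?_
  rw [← (measurePreserving_add_right volume (r : ℝ)).setLIntegral_comp_preimage_emb
    (measurableEmbedding_addRight _) h, preimage_add_int_Ioc]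

variable {h : ℝ → ℂ}

theorem lintegral_tsum_enorm_lt_top (hi : Integrable h) :
    ∫⁻ lam in Set.Ioc (0 : ℝ) 1, ∑' r : ℤ, ‖h (lam + r)‖ₑ < ∞ := by
  rw [setLIntegral_Ioc_tsum (h := fun lam => ‖h lam‖ₑ) hi.1.enorm]
  exact hi.2

theorem aestronglyMeasurable_comp_add_int (hi : Integrable h) (r : ℤ) :
    AEStronglyMeasurable (fun lam : ℝ => h (lam + r)) (volume.restrict (Set.Ioc (0 : ℝ) 1)) :=
  (hi.1.comp_quasiMeasurePreserving
      (measurePreserving_add_right volume (r : ℝ)).quasiMeasurePreserving).restrict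

theorem integrable_periodized (hi : Integrable h) :
    IntegrableOn (fun lam => ∑' r : ℤ, h (lam + r)) (Set.Ioc (0 : ℝ) 1) :=
  ⟨AEStronglyMeasurable.tsum (aestronglyMeasurable_comp_add_int hi),
    (lintegral_mono fun _ => enorm_tsum_le_tsum_enorm).trans_lt (lintegral_tsum_enorm_lt_top hi)⟩

theorem setIntegral_Ioc_tsum (hi : Integrable h) :
    ∫ lam in Set.Ioc (0 : ℝ) 1, ∑' r : ℤ, h (lam + r) = ∫ lam, h lam := by
  have hm := aestronglyMeasurable_comp_add_int hi
  rw [integral_tsum hm]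
  · rw [← setIntegral_univ (f := h), ← iUnion_Ioc_intCast ℝ,
      integral_iUnion (fun r => measurableSet_Ioc) (Set.pairwise_disjoint_Ioc_intCast ℝ)
        hi.integrableOn]
    refine tsum_congr fun r => ?_
    rw [← (measurePreserving_add_right volume (r : ℝ)).setIntegral_preimage_emb
      (measurableEmbedding_addRight _) h, preimage_add_int_Ioc]
  · rw [← lintegral_tsum fun r => (hm r).enorm]
    exact (lintegral_tsum_enorm_lt_top hi).ne

theorem integrableOn_continuousMap_mul (hi : IntegrableOn h (Set.Ioc (0 : ℝ) 1))
    (F : C(AddCircle (1 : ℝ), ℂ)) :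
    IntegrableOn (fun lam : ℝ => F (lam : AddCircle (1 : ℝ)) * h lam) (Set.Ioc (0 : ℝ) 1) :=
  Integrable.bdd_mul (c := ‖F‖) hi
    (F.continuous.comp (AddCircle.continuous_mk' 1)).aestronglyMeasurable
    (ae_of_all _ fun _ => F.norm_coe_le_norm _)

/-- An integrable function on `(0, 1]` with vanishing Fourier coefficients is orthogonal to every
continuous function on the circle, as the trigonometric polynomials are uniformly dense. -/
theorem setIntegral_continuousMap_mul_eq_zero (hi : IntegrableOn h (Set.Ioc (0 : ℝ) 1))
    (h0 : ∀ m : ℤ, ∫ lam in Set.Ioc (0 : ℝ) 1, char (-(lam * m)) * h lam = 0)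
    (F : C(AddCircle (1 : ℝ), ℂ)) :
    ∫ lam in Set.Ioc (0 : ℝ) 1, F (lam : AddCircle (1 : ℝ)) * h lam = 0 := by
  let Λ : C(AddCircle (1 : ℝ), ℂ) →L[ℂ] ℂ := LinearMap.mkContinuous
    { toFun := fun F => ∫ lam in Set.Ioc (0 : ℝ) 1, F (lam : AddCircle (1 : ℝ)) * h lam
      map_add' := fun F G => by
        rw [← integral_add (integrableOn_continuousMap_mul hi F)
          (integrableOn_continuousMap_mul hi G)]
        simp only [ContinuousMap.add_apply, add_mul]
      map_smul' := fun c F => by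
        rw [RingHom.id_apply, ← integral_smul]
        simp only [ContinuousMap.smul_apply, smul_mul_assoc] }
    (∫ lam in Set.Ioc (0 : ℝ) 1, ‖h lam‖) (fun F => by
      rw [mul_comm, ← integral_const_mul]
      refine norm_integral_le_of_norm_le (hi.norm.const_mul ‖F‖) (ae_of_all _ fun lam => ?_)
      rw [norm_mul]
      exact mul_le_mul_of_nonneg_right (F.norm_coe_le_norm _) (norm_nonneg _))
  have hle : (Submodule.span ℂ (Set.range (fourier (T := (1 : ℝ))))).topologicalClosure
      ≤ Λ.ker := by
    refine Submodule.topologicalClosure_minimal _ (Submodule.span_le.2 ?_) Λ.isClosed_ker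
    rintro _ ⟨m, rfl⟩
    change ∫ lam in Set.Ioc (0 : ℝ) 1, fourier m (lam : AddCircle (1 : ℝ)) * h lam = 0
    rw [← h0 (-m)]
    refine integral_congr_ae (ae_of_all _ fun lam => ?_)
    simp only
    rw [fourier_coe_apply, char]
    congr 2
    push_cast
    ring
  rw [span_fourier_closure_eq_top] at hle
  exact hle (Submodule.mem_top : F ∈ ⊤)

theorem ae_eq_zero_of_fourierCoeff_eq_zero (hi : IntegrableOn h (Set.Ioc (0 : ℝ) 1))
    (h0 : ∀ m : ℤ, ∫ lam in Set.Ioc (0 : ℝ) 1, char (-(lam * m)) * h lam = 0) :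
    ∀ᵐ lam ∂(volume.restrict (Set.Ioc (0 : ℝ) 1)), h lam = 0 := by
  have key : ∀ᵐ lam : ℝ, lam ∈ Set.Ioo (0 : ℝ) 1 → h lam = 0 := by
    refine isOpen_Ioo.ae_eq_zero_of_integral_contDiff_smul_eq_zero
      (hi.mono_set Set.Ioo_subset_Ioc_self).locallyIntegrableOn fun g hg _ hsupp => ?_
    have hz : ∀ x, x ∉ Set.Ioo (0 : ℝ) 1 → g x = 0 := fun x hx =>
      image_eq_zero_of_notMem_tsupport fun hx' => hx (hsupp hx')
    let G : ℝ → ℂ := fun x => (g x : ℂ)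
    have hG : Continuous (AddCircle.liftIco 1 0 G) := by
      refine AddCircle.liftIco_zero_continuous ?_ ?_
      · simp [G, hz 0 (by simp), hz 1 (by simp)]
      · exact (Complex.continuous_ofReal.comp hg.continuous).continuousOn
    have h1 := setIntegral_continuousMap_mul_eq_zero hi h0 ⟨_, hG⟩
    rw [setIntegral_congr_set (Ioo_ae_eq_Ioc (μ := volume)).symm] at h1
    rw [← setIntegral_eq_integral_of_forall_compl_eq_zero (s := Set.Ioo (0 : ℝ) 1)
      (fun x hx => by rw [hz x hx, zero_smul]), ← h1]
    refine setIntegral_congr_fun measurableSet_Ioo fun x hx => ?_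
    simp only [ContinuousMap.coe_mk]
    rw [AddCircle.liftIco_zero_coe_apply ⟨hx.1.le, hx.2⟩]
    simp [G]
  rw [← Measure.restrict_congr_set (Ioo_ae_eq_Ioc (μ := volume))]
  exact (ae_restrict_iff' measurableSet_Ioo).2 key

theorem setIntegral_char (m : ℤ) :
    ∫ lam in Set.Ioc (0 : ℝ) 1, char (-(lam * m)) = if m = 0 then 1 else 0 := by
  split_ifs with hm
  · subst hm
    simp [char_zero]
  · rw [← intervalIntegral.integral_of_le zero_le_one]
    have e : (fun lam : ℝ => char (-(lam * m)))
        = fun lam : ℝ => Complex.exp ((-(2 * Real.pi * Complex.I * m)) * lam) := by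
      funext lam
      rw [char]
      congr 1
      push_cast
      ring
    have hc : (-(2 * Real.pi * Complex.I * m) : ℂ) ≠ 0 := by
      simp [hm, Real.pi_ne_zero]
    have e1 : Complex.exp (-(2 * Real.pi * Complex.I * m)) = 1 := by
      rw [← char_int (-m), char]
      congr 1
      push_cast
      ring
    rw [e, integral_exp_mul_complex hc]
    simp [e1]

end Periodization

/-! ### The range map as a fibre decomposition -/

section Fibres

variable {n : ℕ}

theorem integrable_plancherelMeasure_iff {g : ℝ → ℂ} :
    Integrable g (plancherelMeasure n) ↔ Integrable fun lam => ((|lam| ^ n : ℝ) : ℂ) * g lam := by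
  rw [plancherelMeasure, integrable_withDensity_iff_integrable_smul'
    (measurable_plancherel_density n) (ae_of_all _ fun _ => ENNReal.ofReal_lt_top)]
  refine integrable_congr (ae_of_all _ fun lam => ?_)
  simp only
  rw [ENNReal.toReal_ofReal (by positivity), Complex.real_smul]

theorem integral_plancherelMeasure (g : ℝ → ℂ) :
    ∫ lam, g lam ∂(plancherelMeasure n) = ∫ lam, ((|lam| ^ n : ℝ) : ℂ) * g lam := by
  rw [plancherelMeasure, integral_withDensity_eq_integral_toReal_smul
    (measurable_plancherel_density n) (ae_of_all _ fun _ => ENNReal.ofReal_lt_top)]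
  refine integral_congr_ae (ae_of_all _ fun lam => ?_)
  simp only
  rw [ENNReal.toReal_ofReal (by positivity), Complex.real_smul]

theorem integrable_abs_pow_mul_inner (F G : L2HS n) :
    Integrable fun lam : ℝ => ((|lam| ^ n : ℝ) : ℂ) * inner ℂ (F lam) (G lam) :=
  integrable_plancherelMeasure_iff.1 (L2.integrable_inner (𝕜 := ℂ) F G)

theorem inner_L2HS (F G : L2HS n) :
    inner ℂ F G = ∫ lam : ℝ, ((|lam| ^ n : ℝ) : ℂ) * inner ℂ (F lam) (G lam) := by
  rw [L2.inner_def]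
  exact integral_plancherelMeasure fun lam => inner ℂ (F lam) (G lam)

theorem sq_rpow_half (n : ℕ) (x : ℝ) : (|x| ^ ((n : ℝ) / 2)) ^ 2 = |x| ^ n := by
  rw [← Real.rpow_natCast, ← Real.rpow_mul (abs_nonneg x), Nat.cast_ofNat,
    div_mul_cancel₀ _ two_ne_zero, Real.rpow_natCast]

theorem inner_rangeMap_term (n : ℕ) (x : ℝ) (A B : HS (L2R n)) :
    inner ℂ (((|x| ^ ((n : ℝ) / 2) : ℝ) : ℂ) • A) (((|x| ^ ((n : ℝ) / 2) : ℝ) : ℂ) • B)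
      = ((|x| ^ n : ℝ) : ℂ) * inner ℂ A B := by
  rw [inner_smul_left, inner_smul_right, Complex.conj_ofReal, ← mul_assoc, ← Complex.ofReal_mul,
    ← sq, sq_rpow_half]

theorem ae_rangeMap_apply (f : L2H n) :
    ∀ᵐ lam ∂(volume.restrict (Set.Ioc (0 : ℝ) 1)), ∀ r : ℤ,
      rangeMap f lam r = ((|lam + r| ^ ((n : ℝ) / 2) : ℝ) : ℂ) • groupFourier f (lam + r) := by
  have hi := integrable_abs_pow_mul_inner (groupFourier f) (groupFourier f)
  have h := ae_lt_top' (AEMeasurable.tsum fun r : ℤ =>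
    (aestronglyMeasurable_comp_add_int hi r).enorm) (lintegral_tsum_enorm_lt_top hi).ne
  filter_upwards [h] with lam hlam r
  have hmem : Memℓp (fun r : ℤ =>
      ((|lam + r| ^ ((n : ℝ) / 2) : ℝ) : ℂ) • groupFourier f (lam + r)) 2 := by
    refine memℓp_two_of_tsum_enorm_lt (ne_of_lt ?_)
    refine lt_of_eq_of_lt (tsum_congr fun r => ?_) hlam
    rw [← inner_rangeMap_term, inner_self_eq_norm_sq_to_K, enorm_sq_eq_ofReal, ← ofReal_norm]
    simp
  rw [rangeMap, dif_pos hmem]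

theorem ae_hasSum_inner_rangeMap (f g : L2H n) :
    ∀ᵐ lam : ℝ ∂(volume.restrict (Set.Ioc (0 : ℝ) 1)),
      HasSum (fun r : ℤ => ((|lam + r| ^ n : ℝ) : ℂ) *
        inner ℂ (groupFourier f (lam + r)) (groupFourier g (lam + r)))
        (inner ℂ (rangeMap f lam) (rangeMap g lam)) := by
  filter_upwards [ae_rangeMap_apply f, ae_rangeMap_apply g] with lam h1 h2
  have h := lp.hasSum_inner (𝕜 := ℂ) (rangeMap f lam) (rangeMap g lam)
  simpa only [h1, h2, inner_rangeMap_term] using h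

theorem integrableOn_inner_rangeMap (f g : L2H n) :
    IntegrableOn (fun lam => (inner ℂ (rangeMap f lam) (rangeMap g lam) : ℂ))
      (Set.Ioc (0 : ℝ) 1) := by
  refine (integrable_periodized
    (integrable_abs_pow_mul_inner (groupFourier f) (groupFourier g))).congr ?_
  filter_upwards [ae_hasSum_inner_rangeMap f g] with lam h
  exact h.tsum_eq

theorem intVec_zero : (intVec 0 : Rn n) = 0 := by
  ext i
  simp [intVec]

/-- The central lattice points act on `f̂(λ)` by the scalars `e^{2πiλm}`. -/
theorem groupFourier_leftTranslate_central (f : L2H n) (m : ℤ) :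
    ∀ᵐ lam, groupFourier (leftTranslate (latticePoint 0 0 m) f) lam
      = char (lam * m) • groupFourier f lam := by
  filter_upwards [groupFourier_leftTranslate (latticePoint 0 0 m) f] with lam h
  refine HS_ext fun ψ => ?_
  rw [h ψ]
  change _ = char (lam * m) • (groupFourier f lam).toCLM ψ
  generalize (groupFourier f lam).toCLM ψ = χ
  refine Lp.ext ?_
  filter_upwards [schrodinger_ae_eq lam (latticePoint 0 0 m) χ,
    Lp.coeFn_smul (char (lam * m)) χ] with ξ h1 h2
  rw [h1, h2, schrodingerFun, latticePoint, intVec_zero]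
  simp [char_zero]

/-- Integration in stages over `λ ∈ (0, 1]` and `r ∈ ℤ`: as `e^{2πi(λ+r)m} = e^{2πiλm}`, the inner
products with the central translates are Fourier coefficients of the fibrewise inner product. -/
theorem inner_leftTranslate_central (f g : L2H n) (m : ℤ) :
    inner ℂ (leftTranslate (latticePoint 0 0 m) f) g
      = ∫ lam in Set.Ioc (0 : ℝ) 1,
          char (-(lam * m)) * inner ℂ (rangeMap f lam) (rangeMap g lam) := by
  rw [← (groupFourierIsometry n).inner_map_map, groupFourierIsometry_apply,
    groupFourierIsometry_apply, inner_L2HS, ← setIntegral_Ioc_tsum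
      (integrable_abs_pow_mul_inner _ _)]
  refine integral_congr_ae ?_
  filter_upwards [ae_hasSum_inner_rangeMap f g,
    ae_comp_add_int (groupFourier_leftTranslate_central f m)] with lam h1 h2
  rw [← (h1.mul_left (char (-(lam * m)))).tsum_eq]
  refine tsum_congr fun r => ?_
  have h3 : char (-((lam + r) * m)) = char (-(lam * m)) := by
    rw [show -((lam + r) * (m : ℝ)) = -(lam * m) + ((-(r * m) : ℤ) : ℝ) by push_cast; ring,
      char_add, char_int, mul_one]
  rw [h2, inner_smul_left, conj_char, h3]
  ring

end Fibres

/-! ### The periodization of the Weyl kernel -/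

section WeylKernel

variable {n : ℕ}

theorem measurePreserving_add_fst (y : Rn n) :
    MeasurePreserving (fun p : Rn n × Rn n => (p.1 + y, p.2)) volume volume :=
  (measurePreserving_add_right volume y).prod (MeasurePreserving.id volume)

/-- The kernel of `π_λ(g) A` is the kernel of `A`, translated and modulated in the first variable. -/
theorem integralKernel_schrodinger {lam : ℝ} {g : Heis n} {A B : HS (L2R n)}
    (h : ∀ ψ, B.toCLM ψ = schrodinger lam g (A.toCLM ψ)) :
    integralKernel B =ᵐ[volume] fun p => char (lam * g.t) *
      char (lam * (inner ℝ g.x p.1 + (1 / 2) * inner ℝ g.x g.y)) *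
        integralKernel A (p.1 + g.y, p.2) := by
  have hK : MemLp (fun p : Rn n × Rn n => integralKernel A (p.1 + g.y, p.2)) 2 :=
    (Lp.memLp (integralKernel A)).comp_measurePreserving (measurePreserving_add_fst g.y)
  have hL : MemLp (fun p : Rn n × Rn n => char (lam * g.t) *
      char (lam * (inner ℝ g.x p.1 + (1 / 2) * inner ℝ g.x g.y)) *
        integralKernel A (p.1 + g.y, p.2)) 2 := by
    refine hK.of_le ?_ (ae_of_all _ fun p => ?_)
    · refine AEStronglyMeasurable.mul (Continuous.aestronglyMeasurable ?_) hK.1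
      fun_prop
    · rw [norm_mul, norm_mul, norm_char, norm_char, one_mul, one_mul]
  have hB : IsIntegralKernel B.toCLM hL.toLp := fun ψ => by
    rw [h ψ]
    filter_upwards [schrodinger_ae_eq lam g (A.toCLM ψ),
      ae_comp_add_right g.y (isIntegralKernel_integralKernel A ψ),
      Measure.ae_ae_of_ae_prod hL.coeFn_toLp] with ξ h1 h2 h3
    rw [h1, schrodingerFun, h2, ← integral_const_mul]
    refine integral_congr_ae ?_
    filter_upwards [h3] with η hη
    rw [hη]
    ring
  have e : integralKernel B = hL.toLp := by
    rw [integralKernel_eq, LinearIsometryEquiv.symm_apply_eq]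
    exact ((isIntegralKernel_iff B _).1 hB).symm
  rw [e]
  exact hL.coeFn_toLp

theorem measurableSet_floorCell (s : Fin n → ℤ) : MeasurableSet {ξ : Rn n | ∀ i, ⌊ξ i⌋ = s i} := by
  have e : {ξ : Rn n | ∀ i, ⌊ξ i⌋ = s i} = ⋂ i, (fun ξ : Rn n => ⌊ξ i⌋) ⁻¹' {s i} := by
    ext ξ
    simp
  rw [e]
  exact MeasurableSet.iInter fun i =>
    (Int.measurable_floor.comp (by fun_prop : Measurable fun ξ : Rn n => ξ i))
      (measurableSet_singleton _)

/-- The integer translates of the unit cube tile `ℝⁿ`. -/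
theorem hasSum_setIntegral_unitCube {h : Rn n → ℂ} (hi : Integrable h) :
    HasSum (fun s : Fin n → ℤ => ∫ ξ in unitCube n, h (ξ + intVec s)) (∫ ξ, h ξ) := by
  have hU : ⋃ s : Fin n → ℤ, {ξ : Rn n | ∀ i, ⌊ξ i⌋ = s i} = Set.univ := by
    refine Set.eq_univ_of_forall fun ξ => Set.mem_iUnion.2 ⟨fun i => ⌊ξ i⌋, fun i => rfl⟩
  have hd : Pairwise (Function.onFun Disjoint
      fun s : Fin n → ℤ => {ξ : Rn n | ∀ i, ⌊ξ i⌋ = s i}) := fun s t hst =>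
    Set.disjoint_left.2 fun ξ h1 h2 => hst (funext fun i => (h1 i).symm.trans (h2 i))
  have key := hasSum_integral_iUnion (f := h) (μ := volume) measurableSet_floorCell hd
    (by rw [hU]; exact hi.integrableOn)
  rw [hU, setIntegral_univ] at key
  refine key.congr_fun ?_
  intro s
  rw [← (measurePreserving_add_right volume (intVec s)).setIntegral_preimage_emb
    (measurableEmbedding_addRight _) h]
  congr 2
  ext ξ
  simp [unitCube, intVec, Int.floor_eq_zero_iff]

theorem inner_intVec (k s : Fin n → ℤ) :
    (inner ℝ (intVec k) (intVec s) : ℝ) = ((∑ i, s i * k i : ℤ) : ℝ) := by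
  simp [PiLp.inner_apply, intVec]

/-- The summands of `periodization`, for one `r`, add up to a Hilbert–Schmidt inner product. -/
theorem hasSum_periodization_term (k l : Fin n → ℤ) (lam : ℝ) (r : ℤ) {A B : HS (L2R n)}
    (h : ∀ ψ, B.toCLM ψ = schrodinger (lam + r) (latticePoint k l 0) (A.toCLM ψ)) :
    HasSum (fun s : Fin n → ℤ => ∫ ξ in unitCube n, ∫ η : Rn n,
      integralKernel A (ξ + intVec s, η) *
        conj (integralKernel A (ξ + intVec s + intVec l, η)) *
        Complex.exp (-2 * Real.pi * Complex.I * (lam + r) *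
          (inner ℝ (intVec k) (intVec l + (2 : ℝ) • ξ) : ℝ)) *
        Complex.exp (-4 * Real.pi * Complex.I * lam *
          (inner ℝ (intVec k) (intVec s) : ℝ))) (inner ℂ B A) := by
  set H : Rn n × Rn n → ℂ := fun p => integralKernel A p *
    conj (integralKernel A (p.1 + intVec l, p.2)) *
      char (-((lam + r) * inner ℝ (intVec k) (intVec l + (2 : ℝ) • p.1))) with hH
  have hBA : (fun p => (inner ℂ (integralKernel B p) (integralKernel A p) : ℂ)) =ᵐ[volume] H := by
    filter_upwards [integralKernel_schrodinger h] with p hp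
    rw [hp, RCLike.inner_apply, map_mul, map_mul, conj_char, conj_char]
    have e : -((lam + r) * (inner ℝ (intVec k) (intVec l + (2 : ℝ) • p.1) : ℝ))
        = -((lam + r) * ((latticePoint k l 0).t)) + -((lam + r) * (inner ℝ (latticePoint k l 0).x p.1
          + 1 / 2 * inner ℝ (latticePoint k l 0).x (latticePoint k l 0).y)) := by
      simp only [latticePoint, Heis.mk_x, Heis.mk_y, Heis.mk_t, inner_add_right, inner_smul_left,
        inner_smul_right, conj_trivial]
      push_cast
      ring
    rw [hH]
    simp only
    rw [e, char_add, show (latticePoint k l 0).y = intVec l from rfl]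
    ring
  have hHi : Integrable H (volume.prod volume) :=
    (L2.integrable_inner (integralKernel B) (integralKernel A)).congr hBA
  have hint : ∫ p, H p = ∫ ξ, ∫ η, H (ξ, η) := integral_prod H hHi
  rw [inner_eq_inner_integralKernel, L2.inner_def, integral_congr_ae hBA, hint]
  refine (hasSum_setIntegral_unitCube hHi.integral_prod_left).congr_fun ?_
  intro s
  refine integral_congr_ae (ae_of_all _ fun ξ => ?_)
  refine integral_congr_ae (ae_of_all _ fun η => ?_)
  simp only [hH]
  rw [mul_assoc _ (Complex.exp _) (Complex.exp _)]
  congr 1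
  have e1 : Complex.exp (-2 * Real.pi * Complex.I * (lam + r) *
      (inner ℝ (intVec k) (intVec l + (2 : ℝ) • ξ) : ℝ))
      = char (-((lam + r) * inner ℝ (intVec k) (intVec l + (2 : ℝ) • ξ))) := by
    rw [char]
    congr 1
    push_cast
    ring
  have e2 : Complex.exp (-4 * Real.pi * Complex.I * lam * (inner ℝ (intVec k) (intVec s) : ℝ))
      = char (-(2 * lam * inner ℝ (intVec k) (intVec s))) := by
    rw [char]
    congr 1
    push_cast
    ring
  -- The two phases differ by `2 r (k · s)`, an integer.
  have e3 : -((lam + r) * (inner ℝ (intVec k) (intVec l + (2 : ℝ) • (ξ + intVec s)) : ℝ))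
      = -((lam + r) * inner ℝ (intVec k) (intVec l + (2 : ℝ) • ξ))
        + -(2 * lam * inner ℝ (intVec k) (intVec s))
        + ((-(2 * r * ∑ i, s i * k i) : ℤ) : ℝ) := by
    have := inner_intVec k s
    push_cast at this ⊢
    rw [← this]
    simp only [smul_add, inner_add_right, inner_smul_right]
    ring
  rw [e1, e2, e3, char_add, char_add, char_int, mul_one]

theorem ae_periodization_eq (φ : L2H n) (k l : Fin n → ℤ) :
    ∀ᵐ lam ∂(volume.restrict (Set.Ioc (0 : ℝ) 1)), periodization φ k l lam
      = inner ℂ (rangeMap (leftTranslate (latticePoint k l 0) φ) lam) (rangeMap φ lam) := by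
  filter_upwards [ae_hasSum_inner_rangeMap (leftTranslate (latticePoint k l 0) φ) φ,
    ae_comp_add_int (groupFourier_leftTranslate (latticePoint k l 0) φ)] with lam h1 h2
  rw [← h1.tsum_eq, periodization]
  refine tsum_congr fun r => ?_
  exact ((hasSum_periodization_term k l lam r (h2 r)).mul_right _).tsum_eq.trans (mul_comm _ _)

end WeylKernel

/-! ### Lattice translates -/

section Lattice

variable {n : ℕ}

theorem latticePoint_central_mul (k l : Fin n → ℤ) (m : ℤ) :
    latticePoint 0 0 m * latticePoint k l 0 = latticePoint k l m := by
  refine Heis.ext' ?_ ?_ ?_ <;> simp [latticePoint, intVec_zero]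

/-- The points `(2k, l, m)` form a subgroup: the commutator term
`½ (-l'·2k + 2k'·l)` is an integer. -/
theorem latticePoint_inv_mul (k l k' l' : Fin n → ℤ) (m m' : ℤ) :
    (latticePoint k' l' m')⁻¹ * latticePoint k l m
      = latticePoint (k - k') (l - l') (m - m' - ∑ i, k i * l' i + ∑ i, l i * k' i) := by
  have hsub (a b : Fin n → ℤ) : (intVec (a - b) : Rn n) = intVec a - intVec b := by
    ext i; simp [intVec]
  refine Heis.ext' ?_ ?_ ?_
  · simp only [latticePoint, Heis.mul_x, Heis.inv_x, Heis.mk_x, hsub, smul_sub]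
    abel
  · simp only [latticePoint, Heis.mul_y, Heis.inv_y, Heis.mk_y, hsub]
    abel
  · simp only [latticePoint, Heis.mul_t, Heis.inv_t, Heis.inv_x, Heis.inv_y, Heis.mk_x, Heis.mk_y,
      Heis.mk_t, inner_neg_left, inner_smul_left, inner_smul_right, inner_intVec, conj_trivial]
    push_cast
    ring

theorem inner_leftTranslate_leftTranslate (g h : Heis n) (f f' : L2H n) :
    inner ℂ (leftTranslate g f) (leftTranslate h f') = inner ℂ (leftTranslate (h⁻¹ * g) f) f' := by
  rw [← (leftTranslateIsometry h).inner_map_map (leftTranslate (h⁻¹ * g) f) f',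
    leftTranslateIsometry_apply, leftTranslateIsometry_apply, ← leftTranslate_mul,
    mul_inv_cancel_left]

theorem latticePoint_zero : latticePoint (0 : Fin n → ℤ) 0 0 = 1 := by
  refine Heis.ext' ?_ ?_ ?_ <;> simp [latticePoint, intVec_zero]

/-- The inner products with lattice translates as Fourier coefficients. -/
theorem inner_leftTranslate_latticePoint (f g : L2H n) (k l : Fin n → ℤ) (m : ℤ) :
    inner ℂ (leftTranslate (latticePoint k l m) f) g
      = ∫ lam in Set.Ioc (0 : ℝ) 1, char (-(lam * m)) *
          inner ℂ (rangeMap (leftTranslate (latticePoint k l 0) f) lam) (rangeMap g lam) := by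
  rw [← latticePoint_central_mul, leftTranslate_mul, inner_leftTranslate_central]

theorem orthonormal_translateSystem_iff {ι : Type*} (φ : ι → L2H n)
    (horth : ∀ i j : ι, i ≠ j → principalShiftInvariant (φ i) ⟂ principalShiftInvariant (φ j)) :
    Orthonormal ℂ (translateSystem φ) ↔ ∀ (j : ι) (k l : Fin n → ℤ) (m : ℤ),
      (inner ℂ (leftTranslate (latticePoint k l m) (φ j)) (φ j) : ℂ)
        = if (k, l, m) = (0, 0, 0) then 1 else 0 := by
  classical
  rw [orthonormal_iff_ite]
  constructor
  · intro h j k l m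
    have h1 := h (j, k, l, m) (j, 0, 0, 0)
    simp only [translateSystem, latticePoint_zero, leftTranslate_one] at h1
    rw [h1]
    simp only [Prod.mk.injEq, true_and]
  · rintro h ⟨i, k, l, m⟩ ⟨j, k', l', m'⟩
    by_cases hij : i = j
    · subst hij
      simp only [translateSystem]
      rw [inner_leftTranslate_leftTranslate, latticePoint_inv_mul, h]
      refine if_congr ?_ rfl rfl
      simp only [Prod.mk.injEq, true_and, sub_eq_zero]
      constructor
      · rintro ⟨rfl, rfl, h3⟩
        refine ⟨rfl, rfl, ?_⟩
        simp only [mul_comm (l _)] at h3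
        omega
      · rintro ⟨rfl, rfl, rfl⟩
        refine ⟨rfl, rfl, ?_⟩
        simp only [mul_comm (l _)]
        omega
    · rw [if_neg (by simp [hij])]
      have hmem (j : ι) (q : (Fin n → ℤ) × (Fin n → ℤ) × ℤ) :
          translateSystem φ (j, q) ∈ principalShiftInvariant (φ j) :=
        Submodule.le_topologicalClosure _ (Submodule.subset_span ⟨q, rfl⟩)
      exact (horth i j hij).inner_eq (hmem i _) (hmem j _)

/-- For one generator: the translates are orthonormal iff the fibre norm is `1` and condition C
holds, both being statements about the Fourier coefficients of `λ ↦ ⟪𝒯 L f(λ), 𝒯 f(λ)⟫`. -/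
theorem inner_translates_eq_iff (f : L2H n) :
    (∀ (k l : Fin n → ℤ) (m : ℤ), (inner ℂ (leftTranslate (latticePoint k l m) f) f : ℂ)
        = if (k, l, m) = (0, 0, 0) then 1 else 0) ↔
      (∀ᵐ lam ∂(volume.restrict (Set.Ioc (0 : ℝ) 1)), ‖rangeMap f lam‖ = 1) ∧ ConditionC f := by
  constructor
  · intro h
    constructor
    · have hi := integrableOn_inner_rangeMap f f
      have key := ae_eq_zero_of_fourierCoeff_eq_zero
        (h := fun lam => inner ℂ (rangeMap f lam) (rangeMap f lam) - 1)
        (hi.sub (integrable_const 1)) fun m => by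
          have e : ∀ lam : ℝ, char (-(lam * m)) * (inner ℂ (rangeMap f lam) (rangeMap f lam) - 1)
              = char (-(lam * m)) * inner ℂ (rangeMap f lam) (rangeMap f lam)
                - char (-(lam * m)) := fun lam => by ring
          have hc : Continuous fun lam : ℝ => char (-(lam * m)) := by fun_prop
          have hb : ∀ lam : ℝ, ‖char (-(lam * m))‖ ≤ 1 := fun lam => (norm_char _).le
          simp only [e]
          rw [integral_sub (Integrable.bdd_mul hi hc.aestronglyMeasurable (ae_of_all _ hb))
            (Integrable.of_bound hc.aestronglyMeasurable 1 (ae_of_all _ hb)),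
            ← inner_leftTranslate_central, h, setIntegral_char]
          simp
      filter_upwards [key] with lam hlam
      rw [inner_self_eq_norm_sq_to_K, sub_eq_zero] at hlam
      have h1 : ‖rangeMap f lam‖ ^ 2 = 1 := RCLike.ofReal_injective (K := ℂ) (by simpa using hlam)
      exact (pow_eq_one_iff_of_nonneg (norm_nonneg _) two_ne_zero).1 h1
    · intro k l hkl
      have key := ae_eq_zero_of_fourierCoeff_eq_zero
        (integrableOn_inner_rangeMap (leftTranslate (latticePoint k l 0) f) f) fun m => by
          rw [← inner_leftTranslate_latticePoint, h, if_neg]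
          rintro ⟨⟩
          exact hkl rfl
      filter_upwards [key, ae_periodization_eq f k l] with lam h1 h2
      rw [h2, h1]
  · rintro ⟨h1, h2⟩ k l m
    rw [inner_leftTranslate_latticePoint]
    by_cases hkl : (k, l) = (0, 0)
    · obtain ⟨rfl, rfl⟩ := Prod.mk.inj hkl
      have e : ∫ lam in Set.Ioc (0 : ℝ) 1, char (-(lam * m)) *
          inner ℂ (rangeMap (leftTranslate (latticePoint 0 0 0) f) lam) (rangeMap f lam)
          = ∫ lam in Set.Ioc (0 : ℝ) 1, char (-(lam * m)) := by
        refine integral_congr_ae ?_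
        filter_upwards [h1] with lam hlam
        rw [latticePoint_zero, leftTranslate_one, inner_self_eq_norm_sq_to_K, hlam]
        simp
      rw [e, setIntegral_char]
      simp
    · rw [if_neg (by rintro ⟨⟩; exact hkl rfl)]
      refine integral_eq_zero_of_ae ?_
      filter_upwards [h2 k l hkl, ae_periodization_eq f k l] with lam e1 e2
      rw [Pi.zero_apply, ← e2, e1, mul_zero]

theorem ae_inner_rangeMap_eq_zero {f g : L2H n}
    (h : principalShiftInvariant f ⟂ principalShiftInvariant g) :
    ∀ᵐ lam ∂(volume.restrict (Set.Ioc (0 : ℝ) 1)),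
      (inner ℂ (rangeMap f lam) (rangeMap g lam) : ℂ) = 0 := by
  refine ae_eq_zero_of_fourierCoeff_eq_zero (integrableOn_inner_rangeMap f g) fun m => ?_
  rw [← inner_leftTranslate_central]
  refine h.inner_eq (Submodule.le_topologicalClosure _ (Submodule.subset_span ⟨(0, 0, m), rfl⟩))
    (Submodule.le_topologicalClosure _ (Submodule.subset_span ⟨(0, 0, 0), ?_⟩))
  simp only [latticePoint_zero, leftTranslate_one]

end Lattice

end HeisenbergShift

end

theorem theorem3p7 (n : ℕ) {ι : Type*} [Countable ι] (φ : ι → HeisenbergShift.L2H n)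
    (horth : ∀ i j : ι, i ≠ j →
      HeisenbergShift.principalShiftInvariant (φ i) ⟂
        HeisenbergShift.principalShiftInvariant (φ j)) :
    Orthonormal ℂ (HeisenbergShift.translateSystem φ) ↔
      (∀ᵐ lam ∂(MeasureTheory.volume.restrict (Set.Ioc (0 : ℝ) 1)),
        Orthonormal ℂ (fun j : ι => HeisenbergShift.rangeMap (φ j) lam)) ∧
      ∀ j : ι, HeisenbergShift.ConditionC (φ j) := by
  rw [HeisenbergShift.orthonormal_translateSystem_iff φ horth]
  simp only [HeisenbergShift.inner_translates_eq_iff, forall_and]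
  refine and_congr_left fun _ => ?_
  rw [← MeasureTheory.ae_all_iff]
  have h0 : ∀ᵐ lam ∂(MeasureTheory.volume.restrict (Set.Ioc (0 : ℝ) 1)), ∀ i j : ι, i ≠ j →
      (inner ℂ (HeisenbergShift.rangeMap (φ i) lam) (HeisenbergShift.rangeMap (φ j) lam) : ℂ) = 0 :=
    MeasureTheory.ae_all_iff.2 fun i => MeasureTheory.ae_all_iff.2 fun j =>
      MeasureTheory.ae_all_iff.2 fun hij =>
        HeisenbergShift.ae_inner_rangeMap_eq_zero (horth i j hij)
  refine Filter.eventually_congr ?_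
  filter_upwards [h0] with lam hlam
  exact ⟨fun h => ⟨h, fun i j hij => hlam i j hij⟩, fun h => h.1⟩
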